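/- Let $1<p<\infty$. For $F\in L^p(\mathbb{C})$ let $$\mathcal{B}F(z) = -\frac{1}{\pi}\,\mathrm{p.v.}\int_{\mathbb{C}} \frac{F(w)}{(z-w)^2}\,dw = -\frac1\pi\lim_{\varepsilon\to0^+}\int_{|z-w|>\varepsilon}\frac{F(w)}{(z-w)^2}\,dw$$ be the Beurling–Ahlfors transform ($dw$ is Lebesgue measure on $\mathbb{C}$), and call $F$ radial if there is $f$ with $F(z)=f(|z|^2)$ for almost every $z$. Define $C_p\ge 0$ by $$C_p^p = \sup_{\alpha\le (p-1)/p} \frac{|\alpha-1|^p}{p(1-\alpha)-1+|\alpha|^p}.$$ This supremum is finite and $$C_p^p=\begin{cases}\dfrac{1}{(p-1)^p} & \text{if } 1<p\le 2,\\[2mm] \dfrac{(1+|\alpha_p|)^{p-2}}{p-1} & \text{if } p>2,\end{cases}$$ where, for $p>2$, $\alpha_p$ is the unique negative solution of $(p-1)\alpha+2-p=|\alpha|^{p-2}\alpha$. For every complex-valued radial $F\in L^p(\mathbb{C})$ the principal value $\mathcal{B}F(z)$ exists for almost every $z$, $\mathcal{B}F\in L^p(\mathbb{C})$, and $$\|\mathcal{B}F\|_p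 \le C_p\,\|F\|_p .$$ The inequality is sharp: $C_p$ is the smallest constant $C\ge0$ such that $\|\mathcal{B}F\|_p\le C\|F\|_p$ for all complex-valued radial $F\in L^p(\mathbb{C})$. -/

import Mathlib

open MeasureTheory Filter Topology

/-- The truncated Beurling–Ahlfors integral
`-(1/π) ∫_{|z - w| > ε} F(w) / (z - w)^2 dw`, with respect to Lebesgue measure on `ℂ`. -/
noncomputable def beurlingTrunc (F : ℂ → ℂ) (ε : ℝ) (z : ℂ) : ℂ :=
  -(1 / (Real.pi : ℂ)) * ∫ w in {w : ℂ | ε < ‖z - w‖}, F w / (z - w) ^ 2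

/-- The Beurling–Ahlfors transform
`BF(z) = -(1/π) p.v. ∫ F(w) / (z - w)^2 dw`, the limit of the truncated integrals as `ε → 0⁺`. -/
noncomputable def beurling (F : ℂ → ℂ) (z : ℂ) : ℂ :=
  limUnder (𝓝[>] (0 : ℝ)) (fun ε => beurlingTrunc F ε z)

/-- The principal value defining `BF(z)` exists: all truncated integrals converge absolutely, and
they have a limit (which is then `BF(z)`) as `ε → 0⁺`. -/
def BeurlingExistsAt (F : ℂ → ℂ) (z : ℂ) : Prop :=
  (∀ ε : ℝ, 0 < ε → IntegrableOn (fun w => F w / (z - w) ^ 2) {w : ℂ | ε < ‖z - w‖}) ∧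
    Tendsto (fun ε => beurlingTrunc F ε z) (𝓝[>] (0 : ℝ)) (𝓝 (beurling F z))

/-- `F` is radial: `F(z) = f(|z|^2)` for some `f`. As elements of `L^p` are classes of functions
modulo null sets, the equality is required for almost every `z`. -/
def IsRadial (F : ℂ → ℂ) : Prop :=
  ∃ f : ℝ → ℂ, ∀ᵐ z : ℂ, F z = f (‖z‖ ^ 2)

/-- The quotients `|α - 1|^p / (p (1 - α) - 1 + |α|^p)` for `α ≤ (p - 1) / p`. -/
def radialQuotients (p : ℝ) : Set ℝ :=
  {y : ℝ | ∃ α : ℝ, α ≤ (p - 1) / p ∧ y = |α - 1| ^ p / (p * (1 - α) - 1 + |α| ^ p)}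

/-- The constant `C_p`, defined by
`C_p ^ p = sup_{α ≤ (p - 1) / p} |α - 1|^p / (p (1 - α) - 1 + |α|^p)`. -/
noncomputable def radialConst (p : ℝ) : ℝ :=
  (sSup (radialQuotients p)) ^ (1 / p)

/-!
For a radial function `F(z) = f(|z|^2)` the Beurling–Ahlfors transform is one-dimensional:
`BF(z) = (|z|^2 / z^2) (f - Hf)(|z|^2)`, where `Hf(s) = (1/s) ∫_0^s f` is Hardy's averaging
operator. As `z ↦ |z|^2` maps Lebesgue measure on `ℂ` to `π` times Lebesgue measure on `(0, ∞)`, the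
best constant for radial functions is the norm of `I - H` on `L^p(0, ∞)`.

*The formula* (`tendsto_beurlingTrunc`, `ae_beurling_eq`). It holds at every `z` for which `|z|^2` is
a Lebesgue point of `f`. Replacing `f` by `f - f(|z|^2)` on the disc of radius `2|z|` does not change
the truncated integrals (`integral_disc_kernel_eq_zero`), so the new profile may be assumed to vanish
at `|z|^2` in the Lebesgue sense. On circles `|w| = r` the kernel `(z - w)⁻²` has mean `z⁻²` for
`r < |z|` and `0` for `r > |z|`; what remains is the annulus `||w| - |z|| ≤ ε`, where the angular
integral of the truncated kernel is `O(1 / (ε |z|))` (`lintegral_annulus_le`), so that its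
contribution tends to zero at a Lebesgue point.

*The bound* (`lintegral_sub_hardy_le`). With `g = Hf` one has `(s |g|^p)' = |g|^p +
p |g|^(p-2) Re(conj g (f - g))`, and the integral of this derivative over `(0, ∞)` is nonnegative.
Hence it suffices to find `c ≥ 0` with
`|f - g|^p ≤ K |f|^p - c (|g|^p + p |g|^(p-2) Re(conj g (f - g)))` pointwise, where `K = C_p^p`. After
division by `|g|^p` this is an inequality for the complex ratio `α = f / g`. It reduces by concavity
to real `α` (`complex_of_scalar`), where `c` is forced by tangency: at `α = (p - 1) / p` for `p ≤ 2`
(`scalar_lt_two`), and `c = K` with tangency at `α_p` for `p > 2` (`scalar_gt_two`).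

*Sharpness* (`quotient_le_of_bound`). For `α < (p - 1) / p` the profile equal to `1` on `(0, 1]` and
to `α s^(α-1)` beyond attains exactly the quotient at `α`.
-/

/-! ### Monotonicity from derivatives -/

lemma monotoneOn_of_hasDerivAt_nonneg {D : Set ℝ} (hD : Convex ℝ D) {f f' : ℝ → ℝ}
    (hf : ∀ x ∈ D, HasDerivAt f (f' x) x) (h : ∀ x ∈ D, 0 ≤ f' x) : MonotoneOn f D :=
  monotoneOn_of_deriv_nonneg hD (fun x hx => (hf x hx).continuousAt.continuousWithinAt)
    (fun x hx => (hf x (interior_subset hx)).differentiableAt.differentiableWithinAt)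
    (fun x hx => by rw [(hf x (interior_subset hx)).deriv]; exact h x (interior_subset hx))

lemma antitoneOn_of_hasDerivAt_nonpos {D : Set ℝ} (hD : Convex ℝ D) {f f' : ℝ → ℝ}
    (hf : ∀ x ∈ D, HasDerivAt f (f' x) x) (h : ∀ x ∈ D, f' x ≤ 0) : AntitoneOn f D :=
  antitoneOn_of_deriv_nonpos hD (fun x hx => (hf x hx).continuousAt.continuousWithinAt)
    (fun x hx => (hf x (interior_subset hx)).differentiableAt.differentiableWithinAt)
    (fun x hx => by rw [(hf x (interior_subset hx)).deriv]; exact h x (interior_subset hx))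

/-! ### The scalar inequality for `p < 2` -/

/-- An explicit rational bound, from `-log q ≥ 2 (1 - q) / (1 + q)` and
`exp x ≥ 1 + x + x ^ 2 / 2`. -/
lemma rpow_div_one_sub_le {q : ℝ} (h0 : 0 < q) (h1 : q < 1) :
    q ^ (q / (1 - q)) ≤ (1 + q) ^ 2 / (1 + 4 * q + 5 * q ^ 2) := by
  have hlog : 2 * (1 - q) / (1 + q) ≤ -Real.log q := by
    set x := (1 - q) / (1 + q) with hx
    have hx0 : 0 < x := by rw [hx]; apply div_pos <;> linarith
    have hx1 : x < 1 := by rw [hx, div_lt_one (by linarith)]; linarith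
    have hs := Real.hasSum_log_sub_log_of_abs_lt_one (x := x)
      (by rw [abs_lt]; constructor <;> linarith)
    have h2 := sum_le_hasSum {0} (fun k _ => by positivity) hs
    have e : Real.log (1 + x) - Real.log (1 - x) = -Real.log q := by
      have e1 : 1 + x = 2 / (1 + q) := by rw [hx]; field_simp; ring
      have e2 : 1 - x = 2 * q / (1 + q) := by rw [hx]; field_simp; ring
      rw [← Real.log_div (by linarith) (by linarith), ← Real.log_inv, e1, e2]
      congr 1; field_simp
    rw [e] at h2
    simp at h2
    rwa [hx, ← mul_div_assoc] at h2
  have hy : 0 ≤ 2 * q / (1 + q) := by positivity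
  have hle : q ^ (q / (1 - q)) ≤ Real.exp (-(2 * q / (1 + q))) := by
    rw [Real.rpow_def_of_pos h0]
    apply Real.exp_le_exp.2
    have h3 : 0 < 1 - q := by linarith
    have : 2 * (1 - q) / (1 + q) * (q / (1 - q)) ≤ -Real.log q * (q / (1 - q)) :=
      mul_le_mul_of_nonneg_right hlog (by positivity)
    have e : 2 * (1 - q) / (1 + q) * (q / (1 - q)) = 2 * q / (1 + q) := by field_simp
    linarith
  refine hle.trans ?_
  rw [Real.exp_neg]
  have := Real.quadratic_le_exp_of_nonneg hy
  have e : 1 + 2 * q / (1 + q) + (2 * q / (1 + q)) ^ 2 / 2 = (1 + 4 * q + 5 * q ^ 2) / (1 + q) ^ 2 := by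
    field_simp; ring
  rw [e] at this
  rw [← inv_div (1 + 4 * q + 5 * q ^ 2)]
  exact inv_anti₀ (by positivity) this

/-- The weight `l = q ^ ((1 + q) / (1 - q))` makes the concavity inequality `rpow_ge_weighted` strong
enough for the scalar inequality at ratios `x ≥ 1`, where `q = p - 1`. -/
lemma exists_weight {q : ℝ} (h0 : 0 < q) (h1 : q < 1) : ∃ l : ℝ, 0 < l ∧ l < 1 ∧
    (q ^ (1 + q))⁻¹ * l ^ (1 - q) = 1 ∧
    (1 + q) ^ (1 - q) / q ≤ (q ^ (1 + q))⁻¹ * (1 - l) ^ (1 - q) := by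
  have h3 : 0 < 1 - q := by linarith
  set m := q ^ (q / (1 - q)) with hm
  have hmpos : 0 < m := by positivity
  have hl : q ^ ((1 + q) / (1 - q)) = q * m ^ 2 := by
    have e : (1 + q) / (1 - q) = 1 + q / (1 - q) * (2 : ℕ) := by push_cast; field_simp; ring
    rw [hm, ← Real.rpow_natCast, ← Real.rpow_mul h0.le, e, Real.rpow_add h0, Real.rpow_one]
  have key : q * m ^ 2 + (1 + q) * m ≤ 1 := by
    have hmle := rpow_div_one_sub_le h0 h1
    rw [← hm] at hmle
    set M := (1 + q) ^ 2 / (1 + 4 * q + 5 * q ^ 2)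
    have : q * m ^ 2 + (1 + q) * m ≤ q * M ^ 2 + (1 + q) * M := by gcongr
    refine this.trans ?_
    have e : q * M ^ 2 + (1 + q) * M =
        (q * (1 + q) ^ 4 + (1 + q) ^ 3 * (1 + 4 * q + 5 * q ^ 2)) / (1 + 4 * q + 5 * q ^ 2) ^ 2 := by
      simp only [M]; field_simp
    rw [e, div_le_one (by positivity)]
    have : 0 ≤ q ^ 2 * (2 + 6 * q + 2 * q ^ 2 - 6 * q ^ 3) := by
      apply mul_nonneg (by positivity)
      have : q ^ 3 ≤ q := by
        have : q ^ 3 ≤ q ^ 1 := pow_le_pow_of_le_one h0.le h1.le (by norm_num)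
        simpa using this
      nlinarith [sq_nonneg q]
    nlinarith
  refine ⟨q ^ ((1 + q) / (1 - q)), by positivity, Real.rpow_lt_one h0.le h1 (by positivity), ?_, ?_⟩
  · rw [← Real.rpow_mul h0.le, div_mul_cancel₀ _ h3.ne', inv_mul_cancel₀ (by positivity)]
  · have h4 : (1 + q) * m ≤ 1 - q ^ ((1 + q) / (1 - q)) := by rw [hl]; linarith
    have h5 := Real.rpow_le_rpow (by positivity) h4 h3.le
    rw [Real.mul_rpow (by positivity) hmpos.le, hm, ← Real.rpow_mul h0.le,
      div_mul_cancel₀ _ h3.ne'] at h5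
    refine le_trans (le_of_eq ?_) (mul_le_mul_of_nonneg_left h5 (by positivity))
    rw [Real.rpow_add h0, Real.rpow_one]
    field_simp

lemma rpow_ge_weighted {q l y : ℝ} (h0 : 0 < q) (h1 : q < 1) (hl0 : 0 < l) (hl1 : l < 1)
    (hy : 0 ≤ y) : l ^ (1 - q) * y ^ q + (1 - l) ^ (1 - q) ≤ (1 + y) ^ q := by
  have h := (Real.concaveOn_rpow h0.le h1.le).2 (x := y / l) (y := 1 / (1 - l))
    (by simp; positivity) (by simp; linarith) hl0.le (by linarith : 0 ≤ 1 - l) (by ring)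
  have hl2 : 0 < 1 - l := by linarith
  simp only [smul_eq_mul] at h
  rw [mul_div_cancel₀ _ hl0.ne', mul_div_cancel₀ _ hl2.ne', Real.div_rpow hy hl0.le,
    Real.div_rpow zero_le_one hl2.le, Real.one_rpow] at h
  rw [Real.rpow_sub hl0, Real.rpow_sub hl2, Real.rpow_one, Real.rpow_one, add_comm 1 y]
  refine le_trans (le_of_eq ?_) h
  ring

/-- The scalar inequality for `p < 2`. Both sides agree to first order at `x = (p - 1) / p`; on
`[0, 1]` the derivative of the difference is `p` times a concave function minus a constant, outside
`[0, 1]` the difference is monotone. -/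
lemma scalar_lt_two {p : ℝ} (hp : 1 < p) (hp2 : p < 2) (x : ℝ) :
    |x - 1| ^ p ≤ ((p - 1) ^ p)⁻¹ * |x| ^ p + p ^ (2 - p) / (p - 1) * (p * (1 - x) - 1) := by
  obtain ⟨q, rfl⟩ : ∃ q, p = 1 + q := ⟨p - 1, by ring⟩
  have h0 : 0 < q := by linarith
  have h1 : q < 1 := by linarith
  rw [show 1 + q - 1 = q by ring, show 2 - (1 + q) = 1 - q by ring]
  obtain ⟨l, hl0, hl1, hl, hlc⟩ := exists_weight h0 h1
  set K := (q ^ (1 + q))⁻¹ with hK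
  set c := (1 + q) ^ (1 - q) / q with hc
  have hKpos : 0 < K := by positivity
  have hK1 : 1 ≤ K := (one_le_inv₀ (by positivity)).2 (Real.rpow_le_one h0.le h1.le (by linarith))
  have hc1 : 1 ≤ c := by
    rw [hc, one_le_div h0]
    exact h1.le.trans (Real.one_le_rpow (by linarith) (by linarith))
  have hKc : c < K := by
    refine hlc.trans_lt ?_
    have : (1 - l) ^ (1 - q) < 1 := Real.rpow_lt_one (by linarith) (by linarith) (by linarith)
    nlinarith
  have hpow : ∀ y : ℝ, HasDerivAt (fun x => x ^ (1 + q)) ((1 + q) * y ^ q) y := fun y => by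
    simpa using Real.hasDerivAt_rpow_const (x := y) (p := 1 + q) (Or.inr (by linarith))
  have hpow1 : ∀ y : ℝ, HasDerivAt (fun x => (1 + x) ^ (1 + q)) ((1 + q) * (1 + y) ^ q) y :=
    fun y => by simpa using (hpow (1 + y)).comp_const_add 1 y
  have hpow2 : ∀ y : ℝ, HasDerivAt (fun x => (1 - x) ^ (1 + q)) (-((1 + q) * (1 - y) ^ q)) y :=
    fun y => by simpa using (hpow (1 - y)).comp_const_sub 1 y
  rcases le_total x 0 with hx | hx
  · -- `x = -a`: the difference increases in `a`, by subadditivity of `t ↦ t ^ q`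
    obtain ⟨a, rfl⟩ : ∃ a, x = -a := ⟨-x, by ring⟩
    have ha : 0 ≤ a := by linarith
    have hmono : MonotoneOn (fun a => K * a ^ (1 + q) - (1 + a) ^ (1 + q) + c * ((1 + q) * a + q))
        (Set.Ici 0) := by
      apply monotoneOn_of_hasDerivAt_nonneg (convex_Ici 0)
        (f' := fun a => K * ((1 + q) * a ^ q) - (1 + q) * (1 + a) ^ q + c * ((1 + q) * 1))
      · intro y _
        exact (((hpow y).const_mul K).sub (hpow1 y)).add
          ((((hasDerivAt_id y).const_mul _).add_const _).const_mul c)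
      · intro y hy
        have h2 := Real.rpow_add_le_add_rpow zero_le_one (Set.mem_Ici.1 hy) h0.le h1.le
        rw [Real.one_rpow] at h2
        have h3 : y ^ q ≤ K * y ^ q :=
          le_mul_of_one_le_left (Real.rpow_nonneg hy q) hK1
        have : 0 ≤ (1 + q) * (K * y ^ q - (1 + y) ^ q + c) := by
          apply mul_nonneg (by linarith); linarith
        linarith
    have h2 := hmono (Set.mem_Ici.2 le_rfl) ha ha
    simp only [Real.zero_rpow (by linarith : 1 + q ≠ 0), add_zero, Real.one_rpow] at h2
    have h3 : 1 ≤ c * q := by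
      rw [hc, div_mul_cancel₀ _ h0.ne']; exact Real.one_le_rpow (by linarith) (by linarith)
    rw [abs_neg, abs_of_nonneg ha, show |-a - 1| = 1 + a by rw [abs_of_nonpos] <;> linarith]
    nlinarith
  · -- the point of tangency `q / p`
    set x0 := q / (1 + q) with hx0
    have hx0pos : 0 < x0 := by positivity
    have hx01 : x0 < 1 := by rw [hx0, div_lt_one (by linarith)]; linarith
    have hy0 : 1 - x0 = 1 / (1 + q) := by rw [hx0]; field_simp; ring
    have e0 : (1 + q) * x0 = q := by rw [hx0]; field_simp
    have hval : K * x0 ^ (1 + q) = (1 - x0) ^ (1 + q) := by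
      rw [hy0, hx0, hK, Real.div_rpow h0.le (by linarith), Real.div_rpow zero_le_one (by linarith),
        Real.one_rpow]; field_simp
    set k : ℝ → ℝ := fun x => K * x ^ q + (1 - x) ^ q with hk
    have hk0 : k x0 = c := by
      have e1 : q ^ (1 + q) = q * q ^ q := by rw [Real.rpow_add h0, Real.rpow_one]
      have e2 : (1 + q) ^ (1 - q) = (1 + q) / (1 + q) ^ q := by
        rw [Real.rpow_sub (by linarith), Real.rpow_one]
      simp only [hk]
      rw [hy0, hx0, hK, hc, e1, e2, Real.div_rpow h0.le (by linarith),
        Real.div_rpow zero_le_one (by linarith), Real.one_rpow]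
      field_simp
    have hk1 : k 1 = K := by simp [hk, Real.zero_rpow h0.ne']
    have hconc : ConcaveOn ℝ (Set.Icc 0 1) k := by
      have c1 : ConcaveOn ℝ (Set.Icc (0:ℝ) 1) (fun x => K * x ^ q) :=
        ((Real.concaveOn_rpow h0.le h1.le).subset Set.Icc_subset_Ici_self (convex_Icc 0 1)).smul
          hKpos.le
      have c2 : ConcaveOn ℝ (Set.Icc (0:ℝ) 1) (fun x => (1 - x) ^ q) := by
        refine ⟨convex_Icc 0 1, fun x hx y hy a b ha hb hab => ?_⟩
        have := (Real.concaveOn_rpow h0.le h1.le).2 (x := 1 - x) (y := 1 - y)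
          (by simpa using hx.2) (by simpa using hy.2) ha hb hab
        refine this.trans (le_of_eq ?_)
        simp only [smul_eq_mul]
        congr 1
        linear_combination hab
      exact c1.add c2
    have hderiv : ∀ y : ℝ, HasDerivAt
        (fun x => K * x ^ (1 + q) - (1 - x) ^ (1 + q) + c * ((1 + q) * (1 - x) - 1))
        ((1 + q) * (k y - c)) y := fun y => by
      convert! (((hpow y).const_mul K).sub (hpow2 y)).add
          (((((hasDerivAt_id y).const_sub 1).const_mul (1 + q)).sub_const 1).const_mul c) using 1
      simp only [hk]; ring
    have hx0val : K * x0 ^ (1 + q) - (1 - x0) ^ (1 + q) + c * ((1 + q) * (1 - x0) - 1) = 0 := by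
      rw [hval]
      linear_combination (-c) * e0
    have hge : ∀ x, x0 ≤ x → x ≤ 1 →
        0 ≤ K * x ^ (1 + q) - (1 - x) ^ (1 + q) + c * ((1 + q) * (1 - x) - 1) := by
      intro x hxa hxb
      have hm : MonotoneOn
          (fun x => K * x ^ (1 + q) - (1 - x) ^ (1 + q) + c * ((1 + q) * (1 - x) - 1))
          (Set.Icc x0 1) := by
        apply monotoneOn_of_hasDerivAt_nonneg (convex_Icc _ _) (fun y _ => hderiv y)
        intro y hy
        have := hconc.min_le_of_mem_Icc (x := x0) (y := 1) ⟨hx0pos.le, hx01.le⟩ (by simp) hy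
        rw [hk0, hk1, min_eq_left hKc.le] at this
        apply mul_nonneg (by linarith); linarith
      have := hm ⟨le_rfl, hx01.le⟩ ⟨hxa, hxb⟩ hxa
      simp only at this
      linarith
    rcases le_total x 1 with hx1 | hx1
    · rw [abs_of_nonneg hx, show |x - 1| = 1 - x by rw [abs_of_nonpos] <;> linarith]
      rcases le_total x0 x with hxx | hxx
      · linarith [hge x hxx hx1]
      · have hm : AntitoneOn
            (fun x => K * x ^ (1 + q) - (1 - x) ^ (1 + q) + c * ((1 + q) * (1 - x) - 1))
            (Set.Icc 0 x0) := by
          apply antitoneOn_of_hasDerivAt_nonpos (convex_Icc _ _) (fun y _ => hderiv y)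
          intro y hy
          have : k y ≤ c := by
            by_contra hcon
            push Not at hcon
            rcases eq_or_lt_of_le hy.2 with rfl | hlt
            · linarith
            -- otherwise the concave `k` would exceed `c` at both ends of an interval around `x0`
            have hc2 := hconc.2
            have := hc2 (x := y) (y := 1) ⟨hy.1, hy.2.trans hx01.le⟩ (by simp)
              (a := (1 - x0) / (1 - y)) (b := (x0 - y) / (1 - y))
              (div_nonneg (by linarith) (by linarith)) (div_nonneg (by linarith) (by linarith))
              (by have : 1 - y ≠ 0 := by linarith
                  field_simp; ring)
            have e : ((1 - x0) / (1 - y)) • y + ((x0 - y) / (1 - y)) • (1:ℝ) = x0 := by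
              have : 1 - y ≠ 0 := by linarith
              simp only [smul_eq_mul]; field_simp; ring
            rw [e, hk0, hk1] at this
            simp only [smul_eq_mul] at this
            have ha : 0 < (1 - x0) / (1 - y) := div_pos (by linarith) (by linarith)
            have hb : 0 < (x0 - y) / (1 - y) := div_pos (by linarith) (by linarith)
            have hab : (1 - x0) / (1 - y) + (x0 - y) / (1 - y) = 1 := by
              have : 1 - y ≠ 0 := by linarith
              field_simp; ring
            nlinarith
          apply mul_nonpos_of_nonneg_of_nonpos (by linarith); linarith
        have := hm ⟨hx, hxx⟩ ⟨hx0pos.le, le_rfl⟩ hxx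
        simp only at this
        linarith
    · obtain ⟨y, rfl⟩ : ∃ y, x = 1 + y := ⟨x - 1, by ring⟩
      have hy : 0 ≤ y := by linarith
      have hm : MonotoneOn
          (fun y => K * (1 + y) ^ (1 + q) - y ^ (1 + q) - c * ((1 + q) * y + 1)) (Set.Ici 0) := by
        apply monotoneOn_of_hasDerivAt_nonneg (convex_Ici 0)
          (f' := fun y => K * ((1 + q) * (1 + y) ^ q) - (1 + q) * y ^ q - c * ((1 + q) * 1))
        · intro y _
          exact (((hpow1 y).const_mul K).sub (hpow y)).sub
            ((((hasDerivAt_id y).const_mul _).add_const _).const_mul c)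
        · intro y hy
          have h2 := mul_le_mul_of_nonneg_left (rpow_ge_weighted h0 h1 hl0 hl1 (Set.mem_Ici.1 hy))
            hKpos.le
          have h3 : K * (l ^ (1 - q) * y ^ q + (1 - l) ^ (1 - q)) =
            y ^ q + K * (1 - l) ^ (1 - q) := by linear_combination (y ^ q) * hl
          have : 0 ≤ (1 + q) * (K * (1 + y) ^ q - y ^ q - c) := by
            apply mul_nonneg (by linarith); linarith
          linarith
      have h2 := hm (Set.mem_Ici.2 le_rfl) hy hy
      simp only [Real.zero_rpow (by linarith : 1 + q ≠ 0), add_zero, Real.one_rpow, mul_zero] at h2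
      rw [show 1 + y - 1 = y by ring, abs_of_nonneg hy, abs_of_nonneg (by linarith : 0 ≤ 1 + y)]
      linarith

/-! ### The scalar inequality for `p > 2` -/

/-- At nonnegative ratios the quotient is at most `1`. -/
lemma rpow_abs_sub_one_le {p : ℝ} (hp : 2 < p) {x : ℝ} (hx : 0 ≤ x) :
    |x - 1| ^ p ≤ |x| ^ p + (p * (1 - x) - 1) := by
  have hpow : ∀ y : ℝ, HasDerivAt (fun x => x ^ p) (p * y ^ (p - 1)) y := fun y =>
    Real.hasDerivAt_rpow_const (Or.inr (by linarith))
  have hz : (0 : ℝ) ^ p = 0 := Real.zero_rpow (by linarith)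
  rcases le_total x 1 with hx1 | hx1
  · obtain ⟨s, rfl⟩ : ∃ s, x = 1 - s := ⟨1 - x, by ring⟩
    have hm : MonotoneOn (fun s => (1 - s) ^ p + p * s - s ^ p) (Set.Icc 0 1) := by
      apply monotoneOn_of_hasDerivAt_nonneg (convex_Icc 0 1)
        (f' := fun s => -(p * (1 - s) ^ (p - 1)) + p * 1 - p * s ^ (p - 1))
      · intro y _
        exact (((hpow (1 - y)).comp_const_sub 1 y).add ((hasDerivAt_id y).const_mul p)).sub (hpow y)
      · intro y hy
        have h := Real.add_rpow_le_rpow_add (p := p - 1) (a := 1 - y) (b := y) (by linarith [hy.2])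
          hy.1 (by linarith)
        rw [show 1 - y + y = 1 by ring, Real.one_rpow] at h
        have : 0 ≤ p * (1 - ((1 - y) ^ (p - 1) + y ^ (p - 1))) :=
          mul_nonneg (by linarith) (by linarith)
        linarith
    have h := hm (⟨le_rfl, zero_le_one⟩ : (0 : ℝ) ∈ Set.Icc (0 : ℝ) 1)
      (⟨by linarith, by linarith⟩ : s ∈ Set.Icc (0 : ℝ) 1) (by linarith)
    simp only [sub_zero, Real.one_rpow, mul_zero, hz] at h
    rw [abs_of_nonneg hx, show |1 - s - 1| = s by rw [abs_of_nonpos] <;> linarith]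
    linarith
  · obtain ⟨y, rfl⟩ : ∃ y, x = 1 + y := ⟨x - 1, by ring⟩
    have hm : MonotoneOn (fun s => (1 + s) ^ p - p * s - s ^ p) (Set.Ici 0) := by
      apply monotoneOn_of_hasDerivAt_nonneg (convex_Ici 0)
        (f' := fun s => (p * (1 + s) ^ (p - 1)) - p * 1 - p * s ^ (p - 1))
      · intro y _
        exact (((hpow (1 + y)).comp_const_add 1 y).sub ((hasDerivAt_id y).const_mul p)).sub (hpow y)
      · intro y hy
        have h := Real.add_rpow_le_rpow_add (p := p - 1) (a := 1) (b := y) (by linarith)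
          hy (by linarith)
        rw [Real.one_rpow] at h
        have : 0 ≤ p * ((1 + y) ^ (p - 1) - (1 + y ^ (p - 1))) :=
          mul_nonneg (by linarith) (by linarith)
        linarith
    have hy : 0 ≤ y := by linarith
    have h := hm (Set.mem_Ici.2 le_rfl) hy hy
    simp only [add_zero, Real.one_rpow, mul_zero, hz] at h
    rw [abs_of_nonneg hx, show 1 + y - 1 = y by ring, abs_of_nonneg hy]
    linarith

/-- The derivative of `a ↦ (1 + a)^p / (a^p + p (1 + a) - 1)` has the sign of
`(p - 1) a + p - 2 - a^(p - 1)`, which changes only at its positive root. -/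
lemma sign_root {p : ℝ} (hp : 2 < p) {a : ℝ} (ha : 0 < a)
    (hroot : (p - 1) * a + p - 2 = a ^ (p - 1)) {x : ℝ} (hx : 0 < x) :
    (x < a → x ^ (p - 1) < (p - 1) * x + p - 2) ∧ (a < x → (p - 1) * x + p - 2 < x ^ (p - 1)) := by
  have key : ∀ u v : ℝ, 0 < u → u < v →
      ((p - 1) * v + p - 2) * u < ((p - 1) * u + p - 2) * v ∧
        u ^ (p - 1) * v < v ^ (p - 1) * u := by
    intro u v hu huv
    have hv := hu.trans huv
    refine ⟨by nlinarith, ?_⟩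
    have e : ∀ t : ℝ, 0 < t → t ^ (p - 1) = t ^ (p - 2) * t := fun t ht => by
      rw [← Real.rpow_add_one ht.ne']; congr 1; ring
    have := Real.rpow_lt_rpow hu.le huv (by linarith : 0 < p - 2)
    rw [e u hu, e v hv]
    nlinarith [mul_lt_mul_of_pos_right this (mul_pos hu hv)]
  constructor
  · intro h
    obtain ⟨h1, h2⟩ := key x a hx h
    rw [hroot] at h1
    exact lt_of_mul_lt_mul_right (h2.trans h1) ha.le
  · intro h
    obtain ⟨h1, h2⟩ := key a x ha h
    rw [hroot] at h1
    exact lt_of_mul_lt_mul_right (h1.trans h2) ha.le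

lemma exists_root {p : ℝ} (hp : 2 < p) : ∃ a : ℝ, 0 < a ∧ (p - 1) * a + p - 2 = a ^ (p - 1) := by
  set b : ℝ := (2 * (p - 1)) ^ (p - 2)⁻¹ with hb
  have hp2 : 0 < p - 2 := by linarith
  have hb1 : 1 ≤ b := Real.one_le_rpow (by linarith) (by positivity)
  have hb2 : b ^ (p - 1) = 2 * (p - 1) * b := by
    have e : b ^ (p - 1) = b ^ (p - 2) * b := by
      rw [← Real.rpow_add_one (by positivity)]; congr 1; ring
    rw [e, hb, ← Real.rpow_mul (by linarith), inv_mul_cancel₀ hp2.ne', Real.rpow_one]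
  have hcont : ContinuousOn (fun a : ℝ => (p - 1) * a + p - 2 - a ^ (p - 1)) (Set.Icc 0 b) := by
    apply Continuous.continuousOn
    have : Continuous fun a : ℝ => a ^ (p - 1) := Real.continuous_rpow_const (by linarith)
    fun_prop
  have h := intermediate_value_Icc' (by linarith) hcont
  have h0 : (0:ℝ) ∈ Set.Icc ((p - 1) * b + p - 2 - b ^ (p - 1))
      ((p - 1) * 0 + p - 2 - (0 : ℝ) ^ (p - 1)) := by
    rw [Real.zero_rpow (by linarith), hb2]
    constructor <;> nlinarith
  obtain ⟨a, ⟨ha0, _⟩, ha⟩ := h h0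
  simp only at ha
  refine ⟨a, lt_of_le_of_ne ha0 ?_, by linarith⟩
  rintro rfl
  rw [Real.zero_rpow (by linarith)] at ha
  linarith

lemma quotient_at_root {p : ℝ} (hp : 2 < p) {a : ℝ} (ha : 0 < a)
    (hroot : (p - 1) * a + p - 2 = a ^ (p - 1)) :
    (1 + a) ^ p / (a ^ p + p * (1 + a) - 1) = (1 + a) ^ (p - 2) / (p - 1) := by
  have e1 : a ^ p = ((p - 1) * a + p - 2) * a := by
    rw [hroot, ← Real.rpow_add_one ha.ne']; congr 1; ring
  have e2 : (1 + a) ^ p = (1 + a) ^ (p - 2) * (1 + a) ^ 2 := by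
    rw [← Real.rpow_natCast, ← Real.rpow_add (by linarith)]; congr 1; push_cast; ring
  have hp1 : p - 1 ≠ 0 := by linarith
  have e3 : a ^ p + p * (1 + a) - 1 = (p - 1) * (1 + a) ^ 2 := by rw [e1]; ring
  rw [e3, e2]
  field_simp

lemma one_le_of_root {p : ℝ} (hp : 2 < p) {a : ℝ} (ha : 0 < a)
    (hroot : (p - 1) * a + p - 2 = a ^ (p - 1)) : 1 ≤ (1 + a) ^ (p - 2) / (p - 1) := by
  rw [one_le_div (by linarith)]
  have h := Real.add_rpow_le_rpow_add (p := p - 1) zero_le_one ha.le (by linarith)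
  have e : (1 + a) ^ (p - 1) = (1 + a) ^ (p - 2) * (1 + a) := by
    rw [← Real.rpow_add_one (by linarith)]; congr 1; ring
  rw [Real.one_rpow, e, ← hroot] at h
  have : (p - 1) * (1 + a) ≤ (1 + a) ^ (p - 2) * (1 + a) := by linarith
  exact le_of_mul_le_mul_right this (by linarith)

/-- The scalar inequality for `p > 2`, with the same constant in front of both terms: the quotient is
at most `1` at nonnegative ratios, and over negative ratios it has its maximum at `-a`. -/
lemma scalar_gt_two {p : ℝ} (hp : 2 < p) {a : ℝ} (ha : 0 < a)
    (hroot : (p - 1) * a + p - 2 = a ^ (p - 1)) (x : ℝ) :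
    |x - 1| ^ p ≤ (1 + a) ^ (p - 2) / (p - 1) * |x| ^ p +
      (1 + a) ^ (p - 2) / (p - 1) * (p * (1 - x) - 1) := by
  rw [← mul_add]
  rcases le_total 0 x with hx | hx
  · have h := rpow_abs_sub_one_le hp hx
    refine h.trans (le_mul_of_one_le_left (le_trans (by positivity) h) (one_le_of_root hp ha hroot))
  rw [← quotient_at_root hp ha hroot]
  obtain ⟨y, rfl⟩ : ∃ y, x = -y := ⟨-x, by ring⟩
  have hy : 0 ≤ y := by linarith
  rw [abs_neg, abs_of_nonneg hy, show |-y - 1| = 1 + y by rw [abs_of_nonpos] <;> linarith]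
  have hden : ∀ t : ℝ, 0 ≤ t → 0 < t ^ p + p * (1 + t) - 1 := fun t ht => by
    have := Real.rpow_nonneg ht p
    nlinarith
  have hpow : ∀ y : ℝ, HasDerivAt (fun x => x ^ p) (p * y ^ (p - 1)) y := fun y =>
    Real.hasDerivAt_rpow_const (Or.inr (by linarith))
  set R : ℝ → ℝ := fun t => (1 + t) ^ p / (t ^ p + p * (1 + t) - 1) with hR
  have hderiv : ∀ t : ℝ, 0 ≤ t → HasDerivAt R
      ((1 + t) ^ (p - 1) * p * ((p - 1) * t + p - 2 - t ^ (p - 1)) /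
        (t ^ p + p * (1 + t) - 1) ^ 2) t := by
    intro t ht
    have h1 : HasDerivAt (fun t => (1 + t) ^ p) (p * (1 + t) ^ (p - 1)) t :=
      (hpow (1 + t)).comp_const_add 1 t
    have h2 : HasDerivAt (fun t => t ^ p + p * (1 + t) - 1) (p * t ^ (p - 1) + p * 1) t :=
      ((hpow t).add (((hasDerivAt_id t).const_add 1).const_mul p)).sub_const 1
    convert! h1.div h2 (hden t ht).ne' using 1
    congr 1
    have e1 : (1 + t) ^ p = (1 + t) ^ (p - 1) * (1 + t) := by
      rw [← Real.rpow_add_one (by linarith)]; congr 1; ring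
    have e2 : t ^ p = t ^ (p - 1) * t := by
      rcases eq_or_lt_of_le ht with rfl | ht'
      · simp [Real.zero_rpow (by linarith : p ≠ 0)]
      · rw [← Real.rpow_add_one ht'.ne']; congr 1; ring
    rw [e1, e2]; ring
  have hfac : ∀ t : ℝ, 0 ≤ t → 0 ≤ (1 + t) ^ (p - 1) * p := fun t ht => by positivity
  have hle : R y ≤ R a := by
    rcases le_total y a with hya | hya
    · refine monotoneOn_of_hasDerivAt_nonneg (convex_Icc 0 a) (fun t ht => hderiv t ht.1) ?_
        ⟨hy, hya⟩ ⟨ha.le, le_rfl⟩ hya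
      intro t ht
      refine div_nonneg (mul_nonneg (hfac t ht.1) ?_) (sq_nonneg _)
      rcases eq_or_lt_of_le ht.1 with rfl | ht0
      · rw [Real.zero_rpow (by linarith)]; linarith
      rcases eq_or_lt_of_le ht.2 with rfl | hta
      · linarith
      · linarith [(sign_root hp ha hroot ht0).1 hta]
    · refine antitoneOn_of_hasDerivAt_nonpos (convex_Ici a)
        (fun t ht => hderiv t (ha.le.trans ht)) ?_ (Set.mem_Ici.2 le_rfl) hya hya
      intro t ht
      have ht0 : 0 < t := lt_of_lt_of_le ha ht
      refine div_nonpos_of_nonpos_of_nonneg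
        (mul_nonpos_of_nonneg_of_nonpos (hfac t ht0.le) ?_) (sq_nonneg _)
      rcases eq_or_lt_of_le (Set.mem_Ici.1 ht) with rfl | hta
      · linarith
      · linarith [(sign_root hp ha hroot ht0).2 hta]
  have := (div_le_iff₀ (hden y hy)).1 hle
  refine this.trans (le_of_eq ?_)
  simp only [hR]; ring

/-! ### From real to complex ratios -/

/-- Along a set where `‖α - 1‖` (for `p ≤ 2`) or `‖α‖` (for `p ≥ 2`) is constant, the difference of
the two sides is a concave function of `Re α`; the extreme values of `Re α` are real `α`. -/
lemma complex_of_scalar {p K c : ℝ} (hp : 1 < p) (hK : 0 ≤ K)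
    (h : ∀ x : ℝ, |x - 1| ^ p ≤ K * |x| ^ p + c * (p * (1 - x) - 1)) (α : ℂ) :
    ‖α - 1‖ ^ p ≤ K * ‖α‖ ^ p + c * (p * (1 - α.re) - 1) := by
  have hsq : ∀ t : ℝ, (t ^ 2) ^ (p / 2) = |t| ^ p := fun t => by
    rw [← sq_abs, ← Real.rpow_natCast, ← Real.rpow_mul (abs_nonneg t)]; congr 1; push_cast; ring
  have hns : ‖α - 1‖ ^ 2 = ‖α‖ ^ 2 + 1 - 2 * α.re := by
    rw [← Complex.normSq_eq_norm_sq, ← Complex.normSq_eq_norm_sq, Complex.normSq_apply,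
      Complex.normSq_apply]
    simp; ring
  have hlin : ∀ s : Set ℝ, Convex ℝ s →
      ConcaveOn ℝ s (fun x : ℝ => c * (p * (1 - x) - 1)) := fun s hs =>
    ⟨hs, fun x _ y _ a b _ _ hab => le_of_eq (by
      simp only [smul_eq_mul]; linear_combination (c * (p - 1)) * hab)⟩
  rcases le_total p 2 with hp2 | hp2
  · set ρ := ‖α - 1‖ with hρ
    have hρ0 : 0 ≤ ρ := norm_nonneg _
    set s : Set ℝ := Set.Icc (1 - ρ) (1 + ρ)
    have hc1 : ConcaveOn ℝ s (fun x : ℝ => (ρ ^ 2 - 1 + 2 * x) ^ (p / 2)) := by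
      refine ⟨convex_Icc _ _, fun x hx y hy a b ha hb hab => ?_⟩
      have := (Real.concaveOn_rpow (p := p / 2) (by linarith) (by linarith)).2
        (x := ρ ^ 2 - 1 + 2 * x) (y := ρ ^ 2 - 1 + 2 * y)
        (by simp only [Set.mem_Ici]; nlinarith [hx.1, sq_nonneg (1 - ρ)])
        (by simp only [Set.mem_Ici]; nlinarith [hy.1, sq_nonneg (1 - ρ)]) ha hb hab
      refine this.trans (le_of_eq ?_)
      simp only [smul_eq_mul]
      congr 1
      linear_combination (ρ ^ 2 - 1) * hab
    have hconc := (hc1.smul hK).add (hlin s (convex_Icc _ _))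
    have hre : α.re ∈ s := by
      have := Complex.abs_re_le_norm (α - 1)
      rw [Complex.sub_re, Complex.one_re, abs_le] at this
      constructor <;> linarith
    have hmin := hconc.min_le_of_mem_Icc (x := 1 - ρ) (y := 1 + ρ)
      ⟨le_rfl, by linarith⟩ ⟨by linarith, le_rfl⟩ hre
    simp only [smul_eq_mul, Pi.add_apply] at hmin
    rw [show ρ ^ 2 - 1 + 2 * (1 - ρ) = (1 - ρ) ^ 2 by ring,
      show ρ ^ 2 - 1 + 2 * (1 + ρ) = (1 + ρ) ^ 2 by ring, hsq, hsq,
      show ρ ^ 2 - 1 + 2 * α.re = ‖α‖ ^ 2 by linarith, hsq, abs_norm] at hmin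
    refine le_trans (le_min ?_ ?_) hmin
    · have := h (1 - ρ)
      rwa [show 1 - ρ - 1 = -ρ by ring, abs_neg, abs_of_nonneg hρ0] at this
    · have := h (1 + ρ)
      rwa [show 1 + ρ - 1 = ρ by ring, abs_of_nonneg hρ0] at this
  · set r := ‖α‖ with hr
    have hr0 : 0 ≤ r := norm_nonneg _
    set s : Set ℝ := Set.Icc (-r) r
    have hc1 : ConvexOn ℝ s (fun x : ℝ => (r ^ 2 + 1 - 2 * x) ^ (p / 2)) := by
      refine ⟨convex_Icc _ _, fun x hx y hy a b ha hb hab => ?_⟩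
      have := (convexOn_rpow (p := p / 2) (by linarith)).2
        (x := r ^ 2 + 1 - 2 * x) (y := r ^ 2 + 1 - 2 * y)
        (by simp only [Set.mem_Ici]; nlinarith [hx.2, sq_nonneg (1 - r)])
        (by simp only [Set.mem_Ici]; nlinarith [hy.2, sq_nonneg (1 - r)]) ha hb hab
      refine le_trans (le_of_eq ?_) this
      simp only [smul_eq_mul]
      congr 1
      linear_combination (-(r ^ 2 + 1)) * hab
    have hconc := hc1.neg.add (hlin s (convex_Icc _ _))
    have hre : α.re ∈ s := abs_le.1 (Complex.abs_re_le_norm α)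
    have hmin := hconc.min_le_of_mem_Icc (x := -r) (y := r)
      ⟨le_rfl, by linarith⟩ ⟨by linarith, le_rfl⟩ hre
    simp only [Pi.add_apply, Pi.neg_apply] at hmin
    rw [show r ^ 2 + 1 - 2 * (-r) = (-r - 1) ^ 2 by ring,
      show r ^ 2 + 1 - 2 * r = (r - 1) ^ 2 by ring, hsq, hsq, ← hns, hsq, abs_norm] at hmin
    have h1 := h (-r)
    have h2 := h r
    rw [abs_neg, abs_of_nonneg hr0] at h1
    rw [abs_of_nonneg hr0] at h2
    have : -(K * r ^ p) ≤ -‖α - 1‖ ^ p + c * (p * (1 - α.re) - 1) :=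
      le_trans (le_min (by linarith) (by linarith)) hmin
    linarith

/-- The homogeneous form, for `a = f(s)` and `b = Hf(s)`. The bracket is minus the derivative of
`s ↦ s |Hf(s)|^p`. -/
lemma norm_sub_rpow_le {p K c : ℝ} (hp : 1 < p) (hK : 1 ≤ K)
    (h : ∀ x : ℝ, |x - 1| ^ p ≤ K * |x| ^ p + c * (p * (1 - x) - 1)) (a b : ℂ) :
    ‖a - b‖ ^ p ≤ K * ‖a‖ ^ p + c * ((p - 1) * ‖b‖ ^ p - p * (‖b‖ ^ (p - 2) * inner ℝ b a)) := by
  rcases eq_or_ne b 0 with rfl | hb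
  · simp only [sub_zero, norm_zero, inner_zero_left, mul_zero, Real.zero_rpow (by linarith : p ≠ 0),
      add_zero]
    exact le_mul_of_one_le_left (by positivity) hK
  have hb' : 0 < ‖b‖ := norm_pos_iff.2 hb
  have h1 := complex_of_scalar hp (by linarith) h (a / b)
  have e1 : ‖a / b - 1‖ = ‖a - b‖ / ‖b‖ := by rw [← norm_div]; congr 1; field_simp
  have e2 : (a / b).re = inner ℝ b a / ‖b‖ ^ 2 := by
    rw [Complex.inner, Complex.div_re, ← Complex.normSq_eq_norm_sq]
    simp; ring
  rw [e1, norm_div, e2, Real.div_rpow (by positivity) hb'.le, Real.div_rpow (by positivity) hb'.le]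
    at h1
  have h2 := mul_le_mul_of_nonneg_right h1 (by positivity : 0 ≤ ‖b‖ ^ p)
  have e3 : ‖b‖ ^ (p - 2) = ‖b‖ ^ p / ‖b‖ ^ 2 := by
    rw [Real.rpow_sub hb', Real.rpow_ofNat]
  have hbp : ‖b‖ ^ p ≠ 0 := by positivity
  rw [div_mul_cancel₀ _ hbp] at h2
  refine h2.trans (le_of_eq ?_)
  rw [e3]
  field_simp
  ring

/-! ### The values of the sharp constant -/

lemma radialQuotients_den_pos {p : ℝ} (hp : 1 < p) {α : ℝ} (hα : α ≤ (p - 1) / p) :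
    0 ≤ p * (1 - α) - 1 ∧ 0 < p * (1 - α) - 1 + |α| ^ p := by
  have h1 : α * p ≤ p - 1 := (le_div_iff₀ (by linarith)).1 hα
  refine ⟨by linarith, ?_⟩
  rcases eq_or_ne α 0 with rfl | h
  · rw [abs_zero, Real.zero_rpow (by linarith)]; linarith
  · have : 0 < |α| ^ p := Real.rpow_pos_of_pos (abs_pos.2 h) p
    linarith

lemma isLUB_radialQuotients_of_scalar {p K c : ℝ} (hp : 1 < p)
    (h : ∀ x : ℝ, |x - 1| ^ p ≤ K * |x| ^ p + c * (p * (1 - x) - 1))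
    (hK : K ∈ radialQuotients p) : IsLUB (radialQuotients p) K := by
  have hcK : c ≤ K := by
    have := h 1
    simp [Real.zero_rpow (by linarith : p ≠ 0)] at this
    linarith
  refine ⟨?_, fun b hb => hb hK⟩
  rintro y ⟨α, hα, rfl⟩
  obtain ⟨h1, h2⟩ := radialQuotients_den_pos hp hα
  rw [div_le_iff₀ h2]
  have := h α
  nlinarith [mul_le_mul_of_nonneg_right hcK h1]

/-- The extremal constant `K = C_p ^ p`, together with the multiplier `c` of the derivative term for
which the scalar inequality holds at every real ratio. -/
lemma exists_sharp_constants {p : ℝ} (hp : 1 < p) : ∃ K c : ℝ, 1 ≤ K ∧ 0 ≤ c ∧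
    (∀ x : ℝ, |x - 1| ^ p ≤ K * |x| ^ p + c * (p * (1 - x) - 1)) ∧
    IsLUB (radialQuotients p) K ∧ (p ≤ 2 → K = (1 / (p - 1)) ^ p) ∧
    (2 < p → ∀ a : ℝ, 0 < a → (p - 1) * a + p - 2 = a ^ (p - 1) →
      K = (1 + a) ^ (p - 2) / (p - 1)) := by
  have hp0 : 0 < p := by linarith
  have hp1 : 0 < p - 1 := by linarith
  rcases le_or_gt p 2 with hp2 | hp2
  · obtain ⟨c, hc0, hc⟩ : ∃ c : ℝ, 0 ≤ c ∧ ∀ x : ℝ,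
        |x - 1| ^ p ≤ ((p - 1) ^ p)⁻¹ * |x| ^ p + c * (p * (1 - x) - 1) := by
      rcases eq_or_lt_of_le hp2 with rfl | hp2
      · refine ⟨1, zero_le_one, fun x => le_of_eq ?_⟩
        rw [Real.rpow_ofNat, Real.rpow_ofNat, Real.rpow_ofNat, sq_abs, sq_abs]
        ring
      · exact ⟨_, by positivity, scalar_lt_two hp hp2⟩
    have e : ((p - 1) ^ p)⁻¹ = (1 / (p - 1)) ^ p := by
      rw [Real.div_rpow zero_le_one hp1.le, Real.one_rpow, one_div]
    refine ⟨((p - 1) ^ p)⁻¹, c, ?_, hc0, hc, isLUB_radialQuotients_of_scalar hp hc ?_, fun _ => e,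
      fun h => absurd h (not_lt.2 hp2)⟩
    · exact (one_le_inv₀ (by positivity)).2 (Real.rpow_le_one hp1.le (by linarith) hp0.le)
    · refine ⟨(p - 1) / p, le_rfl, ?_⟩
      have e1 : p * (1 - (p - 1) / p) - 1 = 0 := by field_simp; ring
      have e2 : |(p - 1) / p - 1| = 1 / p := by
        rw [show (p - 1) / p - 1 = -(1 / p) by field_simp; ring, abs_neg, abs_of_nonneg]
        positivity
      rw [e1, e2, zero_add, abs_of_nonneg (by positivity), e,
        ← Real.div_rpow (by positivity) (by positivity)]
      congr 1
      field_simp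
  · obtain ⟨a, ha, hroot⟩ := exists_root hp2
    have hs := scalar_gt_two hp2 ha hroot
    refine ⟨(1 + a) ^ (p - 2) / (p - 1), (1 + a) ^ (p - 2) / (p - 1), one_le_of_root hp2 ha hroot,
      by positivity, hs, isLUB_radialQuotients_of_scalar hp hs ?_,
      fun h => absurd hp2 (not_lt.2 h), fun _ b hb hbroot => ?_⟩
    · refine ⟨-a, le_trans (by linarith) (by positivity : 0 ≤ (p - 1) / p), ?_⟩
      rw [abs_neg, abs_of_pos ha, show |-a - 1| = 1 + a by rw [abs_of_nonpos] <;> linarith,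
        ← quotient_at_root hp2 ha hroot]
      congr 1; ring
    · have : b = a := by
        rcases lt_trichotomy b a with h | h | h
        · linarith [(sign_root hp2 ha hroot hb).1 h]
        · exact h
        · linarith [(sign_root hp2 ha hroot hb).2 h]
      rw [this]

lemma neg_root_iff {p : ℝ} {α : ℝ} (hα : α < 0) :
    (p - 1) * α + 2 - p = |α| ^ (p - 2) * α ↔ (p - 1) * (-α) + p - 2 = (-α) ^ (p - 1) := by
  have e : (-α) ^ (p - 1) = |α| ^ (p - 2) * (-α) := by
    rw [abs_of_neg hα, ← Real.rpow_add_one (by linarith)]; congr 1; ring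
  rw [e]
  constructor <;> intro h <;> linarith

lemma existsUnique_neg_root {p : ℝ} (hp : 2 < p) :
    ∃! α : ℝ, α < 0 ∧ (p - 1) * α + 2 - p = |α| ^ (p - 2) * α := by
  obtain ⟨a, ha, hroot⟩ := exists_root hp
  have ha' : -a < 0 := by linarith
  refine ⟨-a, ⟨ha', (neg_root_iff ha').2 (by simpa using hroot)⟩, ?_⟩
  rintro β ⟨hβ, hβr⟩
  have hb := (neg_root_iff hβ).1 hβr
  have hβ' : 0 < -β := by linarith
  rcases lt_trichotomy (-β) a with h | h | h
  · linarith [(sign_root hp ha hroot hβ').1 h]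
  · linarith
  · linarith [(sign_root hp ha hroot hβ').2 h]

/-! ### The `L^p` inequality for the Hardy operator minus the identity -/

/-- The Hardy averaging operator `Hf(s) = (1/s) ∫_0^s f`. -/
noncomputable def hardy (f : ℝ → ℂ) (s : ℝ) : ℂ := (s : ℂ)⁻¹ * ∫ t in (0 : ℝ)..s, f t

lemma AbsolutelyContinuousOnInterval.of_dist_le {X Y : Type*} [PseudoMetricSpace X]
    [PseudoMetricSpace Y] {f : ℝ → X} {g : ℝ → Y} {a b C : ℝ}
    (hg : AbsolutelyContinuousOnInterval g a b)
    (h : ∀ x ∈ Set.uIcc a b, ∀ y ∈ Set.uIcc a b, dist (f x) (f y) ≤ C * dist (g x) (g y)) :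
    AbsolutelyContinuousOnInterval f a b := by
  have h0 := (Tendsto.const_mul C hg)
  rw [mul_zero] at h0
  refine squeeze_zero' (Eventually.of_forall fun E => Finset.sum_nonneg fun i _ => dist_nonneg) ?_ h0
  filter_upwards [mem_inf_of_right (mem_principal_self _)] with E hE
  rw [Finset.mul_sum]
  exact Finset.sum_le_sum fun i hi => h _ (hE.1 i hi).1 _ (hE.1 i hi).2

lemma intervalIntegrable_of_memLp {f : ℝ → ℂ} {p : ℝ} (hp : 1 < p)
    (hf : MemLp f (ENNReal.ofReal p) (volume.restrict (Set.Ioi 0))) {a b : ℝ} (ha : 0 ≤ a)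
    (hb : 0 ≤ b) : IntervalIntegrable f volume a b := by
  rw [intervalIntegrable_iff]
  have hsub : Set.uIoc a b ⊆ Set.Ioi 0 := fun x hx => lt_of_le_of_lt (le_min ha hb) hx.1
  have : IsFiniteMeasure (volume.restrict (Set.uIoc a b)) := by
    rw [Set.uIoc]; infer_instance
  have h1 : MemLp f (ENNReal.ofReal p) (volume.restrict (Set.uIoc a b)) :=
    hf.mono_measure (Measure.restrict_mono hsub le_rfl)
  exact h1.integrable (by rw [ENNReal.one_le_ofReal]; exact hp.le)

/-- `t ^ (1 - p) * ‖∫_0^t f‖ ^ p` is `t |Hf(t)|^p`, written so that only the primitive of `f` is not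
smooth. -/
lemma absolutelyContinuous_hardy_energy {f : ℝ → ℂ} {p a b : ℝ} (hp : 1 < p) (ha : 0 < a)
    (hab : a ≤ b) (hf : IntervalIntegrable f volume 0 b) :
    AbsolutelyContinuousOnInterval
      (fun t => t ^ (1 - p) * ‖∫ s in (0 : ℝ)..t, f s‖ ^ p) a b := by
  have hI : ∀ x ∈ Set.Icc a b, IntervalIntegrable f volume 0 x := fun x hx =>
    hf.mono_set (by rw [Set.uIcc_of_le (by linarith [hx.1]), Set.uIcc_of_le (by linarith)]
                    exact Set.Icc_subset_Icc le_rfl hx.2)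
  have h1 : AbsolutelyContinuousOnInterval (fun t : ℝ => t ^ (1 - p)) a b := by
    apply ContDiffOn.absolutelyContinuousOnInterval
    intro x hx
    rw [Set.uIcc_of_le hab] at hx
    exact (Real.contDiffAt_rpow_const_of_ne (by linarith [hx.1])).contDiffWithinAt
  have h2 : AbsolutelyContinuousOnInterval (fun t => ‖∫ s in (0 : ℝ)..t, f s‖) a b := by
    have hn : IntervalIntegrable (fun s => ‖f s‖) volume a b := by
      refine hf.norm.mono_set ?_
      rw [Set.uIcc_of_le hab, Set.uIcc_of_le (by linarith)]
      exact Set.Icc_subset_Icc ha.le le_rfl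
    have hac := hn.absolutelyContinuousOnInterval_intervalIntegral (c := a) (by simp)
    refine hac.of_dist_le (C := 1) fun x hx y hy => ?_
    rw [Set.uIcc_of_le hab] at hx hy
    have hn' : ∀ z ∈ Set.Icc a b, IntervalIntegrable (fun s => ‖f s‖) volume a z := fun z hz =>
      hn.mono_set (by rw [Set.uIcc_of_le hz.1, Set.uIcc_of_le hab]
                      exact Set.Icc_subset_Icc le_rfl hz.2)
    rw [one_mul, Real.dist_eq, Real.dist_eq]
    refine (abs_norm_sub_norm_le _ _).trans ?_
    rw [intervalIntegral.integral_interval_sub_left (hI x hx) (hI y hy),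
      intervalIntegral.integral_interval_sub_left (hn' x hx) (hn' y hy)]
    exact intervalIntegral.norm_integral_le_abs_integral_norm
  obtain ⟨M, hM⟩ := h2.exists_bound
  have h3 : AbsolutelyContinuousOnInterval (fun t => ‖∫ s in (0 : ℝ)..t, f s‖ ^ p) a b := by
    have hlip : ∀ u ∈ Set.Icc 0 M, ∀ v ∈ Set.Icc 0 M,
        ‖v ^ p - u ^ p‖ ≤ p * M ^ (p - 1) * ‖v - u‖ := by
      intro u hu v hv
      refine (convex_Icc 0 M).norm_image_sub_le_of_norm_hasDerivWithin_le
        (f' := fun x => p * x ^ (p - 1))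
        (fun x _ => (Real.hasDerivAt_rpow_const (Or.inr hp.le)).hasDerivWithinAt) ?_ hu hv
      intro x hx
      have := Real.rpow_nonneg hx.1 (p - 1)
      rw [Real.norm_of_nonneg (by positivity)]
      have := Real.rpow_le_rpow hx.1 hx.2 (by linarith : 0 ≤ p - 1)
      gcongr
    refine h2.of_dist_le (C := p * M ^ (p - 1)) fun x hx y hy => ?_
    have hx' := hM x hx
    have hy' := hM y hy
    rw [norm_norm] at hx' hy'
    exact hlip _ ⟨norm_nonneg _, hy'⟩ _ ⟨norm_nonneg _, hx'⟩
  exact h1.mul h3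

lemma hasDerivAt_hardy_energy {f : ℝ → ℂ} {p t : ℝ} (hp : 1 < p) (ht : 0 < t)
    (h : HasDerivAt (fun x => ∫ s in (0 : ℝ)..x, f s) (f t) t) :
    HasDerivAt (fun t => t ^ (1 - p) * ‖∫ s in (0 : ℝ)..t, f s‖ ^ p)
      (-((p - 1) * ‖hardy f t‖ ^ p - p * (‖hardy f t‖ ^ (p - 2) * inner ℝ (hardy f t) (f t)))) t := by
  set G := ∫ s in (0 : ℝ)..t, f s with hG
  have h1 : HasDerivAt (fun t : ℝ => t ^ (1 - p)) ((1 - p) * t ^ (1 - p - 1)) t :=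
    Real.hasDerivAt_rpow_const (Or.inl ht.ne')
  have h2 : HasDerivAt (fun t => ‖∫ s in (0 : ℝ)..t, f s‖ ^ p)
      (p * ‖G‖ ^ (p - 2) * inner ℝ G (f t)) t := by
    exact (hasFDerivAt_norm_rpow G hp).comp_hasDerivAt t h
  convert! h1.mul h2 using 1
  have e1 : hardy f t = (t⁻¹ : ℝ) • G := by simp [hardy, hG]
  have e2 : ‖hardy f t‖ = ‖G‖ / t := by
    rw [e1, norm_smul, Real.norm_of_nonneg (by positivity)]; ring
  have e3 : t ^ (1 - p) = t / t ^ p := by rw [Real.rpow_sub ht, Real.rpow_one]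
  have e4 : t ^ (1 - p - 1) = 1 / t ^ p := by
    rw [show 1 - p - 1 = 0 - p by ring, Real.rpow_sub ht, Real.rpow_zero]
  have e5 : t ^ (p - 2) = t ^ p / t ^ 2 := by rw [Real.rpow_sub ht, Real.rpow_ofNat]
  have htp : t ^ p ≠ 0 := by positivity
  rw [e2, e1, inner_smul_left, Real.div_rpow (norm_nonneg _) ht.le,
    Real.div_rpow (norm_nonneg _) ht.le, e3, e4, e5]
  simp only [conj_trivial]
  field_simp
  ring

lemma lintegral_sub_hardy_le_of_pos {f : ℝ → ℂ} {p K c a b : ℝ} (hp : 1 < p) (hK : 1 ≤ K)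
    (hc : 0 ≤ c) (h : ∀ x : ℝ, |x - 1| ^ p ≤ K * |x| ^ p + c * (p * (1 - x) - 1))
    (hf : MemLp f (ENNReal.ofReal p) (volume.restrict (Set.Ioi 0))) (ha : 0 < a) (hab : a ≤ b) :
    ∫⁻ s in Set.Ioc a b, ‖f s - hardy f s‖ₑ ^ p ≤
      ENNReal.ofReal K * (∫⁻ s in Set.Ioi 0, ‖f s‖ₑ ^ p) +
        ENNReal.ofReal (c * (a ^ (1 - p) * ‖∫ s in (0 : ℝ)..a, f s‖ ^ p)) := by
  set E : ℝ → ℝ := fun t => t ^ (1 - p) * ‖∫ s in (0 : ℝ)..t, f s‖ ^ p with hE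
  have hp0 : 0 < p := by linarith
  have hint := intervalIntegrable_of_memLp hp hf le_rfl (ha.le.trans hab)
  have hac := absolutelyContinuous_hardy_energy hp ha hab hint
  have hder : ∀ᵐ t, t ∈ Set.Ioc a b → deriv E t =
      -((p - 1) * ‖hardy f t‖ ^ p - p * (‖hardy f t‖ ^ (p - 2) * inner ℝ (hardy f t) (f t))) := by
    filter_upwards [hint.ae_hasDerivAt_integral] with t ht htab
    have h0 : 0 < t := ha.trans htab.1
    have hb0 : 0 ≤ b := ha.le.trans hab
    refine (hasDerivAt_hardy_energy hp h0 (ht ?_ 0 (by simp))).deriv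
    rw [Set.uIcc_of_le hb0]
    exact ⟨h0.le, htab.2⟩
  have hfp : IntegrableOn (fun t => ‖f t‖ ^ p) (Set.Ioc a b) := by
    have h1 := hf.integrable_norm_rpow (by simpa using hp0) ENNReal.ofReal_ne_top
    rw [ENNReal.toReal_ofReal hp0.le] at h1
    exact IntegrableOn.mono_set h1 (fun x hx => ha.trans hx.1)
  have hdi : IntegrableOn (deriv E) (Set.Ioc a b) :=
    (intervalIntegrable_iff_integrableOn_Ioc_of_le hab).1 hac.intervalIntegrable_deriv
  have hR : IntegrableOn (fun t => K * ‖f t‖ ^ p - c * deriv E t) (Set.Ioc a b) :=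
    (hfp.const_mul K).sub (hdi.const_mul c)
  have hpt : ∀ᵐ t ∂volume.restrict (Set.Ioc a b),
      ‖f t - hardy f t‖ ^ p ≤ K * ‖f t‖ ^ p - c * deriv E t := by
    rw [ae_restrict_iff' measurableSet_Ioc]
    filter_upwards [hder] with t ht htab
    rw [ht htab]
    have := norm_sub_rpow_le hp hK h (f t) (hardy f t)
    linarith
  calc ∫⁻ s in Set.Ioc a b, ‖f s - hardy f s‖ₑ ^ p
      ≤ ∫⁻ s in Set.Ioc a b, ENNReal.ofReal (K * ‖f s‖ ^ p - c * deriv E s) := by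
        refine lintegral_mono_ae ?_
        filter_upwards [hpt] with t ht
        rw [← ofReal_norm, ENNReal.ofReal_rpow_of_nonneg (norm_nonneg _) hp0.le]
        exact ENNReal.ofReal_le_ofReal ht
    _ = ENNReal.ofReal (∫ s in Set.Ioc a b, (K * ‖f s‖ ^ p - c * deriv E s)) := by
        rw [ofReal_integral_eq_lintegral_ofReal hR]
        filter_upwards [hpt] with t ht
        exact le_trans (by positivity) ht
    _ ≤ ENNReal.ofReal (K * (∫ s in Set.Ioc a b, ‖f s‖ ^ p) + c * E a) := by
        apply ENNReal.ofReal_le_ofReal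
        rw [integral_sub (hfp.const_mul K) (hdi.const_mul c), integral_const_mul,
          integral_const_mul, ← intervalIntegral.integral_of_le hab (f := deriv E),
          hac.integral_deriv_eq_sub]
        have hEb : 0 ≤ E b := by
          have : 0 < b := by linarith
          simp only [hE]; positivity
        nlinarith [mul_nonneg hc hEb]
    _ ≤ _ := by
        refine ENNReal.ofReal_add_le.trans ?_
        gcongr
        rw [ENNReal.ofReal_mul (by linarith)]
        gcongr
        rw [ofReal_integral_eq_lintegral_ofReal hfp
          (Eventually.of_forall fun t => by positivity)]
        refine (lintegral_mono_set (fun x hx => ha.trans hx.1 : Set.Ioc a b ⊆ Set.Ioi 0)).trans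
          (le_of_eq (lintegral_congr fun t => ?_))
        rw [← ofReal_norm, ENNReal.ofReal_rpow_of_nonneg (norm_nonneg _) hp0.le]

/-- Hölder's inequality: `a |Hf(a)|^p ≤ ∫_0^a |f|^p`. -/
lemma hardy_energy_le {f : ℝ → ℂ} {p a : ℝ} (hp : 1 < p)
    (hf : MemLp f (ENNReal.ofReal p) (volume.restrict (Set.Ioi 0))) (ha : 0 < a) :
    ENNReal.ofReal (a ^ (1 - p) * ‖∫ s in (0 : ℝ)..a, f s‖ ^ p) ≤
      ∫⁻ s in Set.Ioc 0 a, ‖f s‖ₑ ^ p := by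
  have hp0 : 0 < p := by linarith
  set A := ∫⁻ s in Set.Ioc 0 a, ‖f s‖ₑ ^ p with hA
  have hm : AEStronglyMeasurable f (volume.restrict (Set.Ioc 0 a)) :=
    hf.1.mono_measure (Measure.restrict_mono (fun x hx => hx.1) le_rfl)
  have h1 := eLpNorm_le_eLpNorm_mul_rpow_measure_univ (p := 1) (q := ENNReal.ofReal p)
    (by rw [ENNReal.one_le_ofReal]; exact hp.le) hm
  rw [eLpNorm_one_eq_lintegral_enorm, eLpNorm_eq_lintegral_rpow_enorm_toReal (by simpa using hp0)
    ENNReal.ofReal_ne_top, ENNReal.toReal_ofReal hp0.le] at h1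
  simp only [Measure.restrict_apply_univ, Real.volume_Ioc, sub_zero, ENNReal.toReal_one,
    ← hA] at h1
  have h2 : ‖∫ s in (0 : ℝ)..a, f s‖ₑ ≤ A ^ (1 / p) * ENNReal.ofReal a ^ (1 / 1 - 1 / p) := by
    rw [intervalIntegral.integral_of_le ha.le]
    exact (enorm_integral_le_lintegral_enorm _).trans h1
  have h3 := ENNReal.rpow_le_rpow h2 hp0.le
  rw [ENNReal.mul_rpow_of_nonneg _ _ hp0.le, ← ENNReal.rpow_mul, ← ENNReal.rpow_mul,
    div_mul_cancel₀ _ hp0.ne', ENNReal.rpow_one,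
    show (1 / 1 - 1 / p) * p = p - 1 by field_simp] at h3
  rw [ENNReal.ofReal_mul (by positivity), ← ENNReal.ofReal_rpow_of_nonneg (norm_nonneg _) hp0.le,
    ofReal_norm]
  calc ENNReal.ofReal (a ^ (1 - p)) * ‖∫ s in (0 : ℝ)..a, f s‖ₑ ^ p
      ≤ ENNReal.ofReal (a ^ (1 - p)) * (A * ENNReal.ofReal a ^ (p - 1)) := by gcongr
    _ = A * ENNReal.ofReal (a ^ (1 - p) * a ^ (p - 1)) := by
        rw [ENNReal.ofReal_mul (by positivity), ENNReal.ofReal_rpow_of_pos ha]; ring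
    _ = A := by rw [← Real.rpow_add ha]; simp

/-- The sharp inequality `‖f - Hf‖_p ≤ C_p ‖f‖_p` on the half line, in integrated form. -/
theorem lintegral_sub_hardy_le {f : ℝ → ℂ} {p K c : ℝ} (hp : 1 < p) (hK : 1 ≤ K)
    (hc : 0 ≤ c) (h : ∀ x : ℝ, |x - 1| ^ p ≤ K * |x| ^ p + c * (p * (1 - x) - 1))
    (hf : MemLp f (ENNReal.ofReal p) (volume.restrict (Set.Ioi 0))) :
    ∫⁻ s in Set.Ioi 0, ‖f s - hardy f s‖ₑ ^ p ≤
      ENNReal.ofReal K * ∫⁻ s in Set.Ioi 0, ‖f s‖ₑ ^ p := by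
  have hp0 : 0 < p := by linarith
  have hfin : ∫⁻ s in Set.Ioi 0, ‖f s‖ₑ ^ p ≠ ⊤ := by
    have := lintegral_rpow_enorm_lt_top_of_eLpNorm_lt_top (by simpa using hp0) ENNReal.ofReal_ne_top
      hf.2
    rw [ENNReal.toReal_ofReal hp0.le] at this
    exact this.ne
  set u : ℕ → ℝ := fun n => 1 / ((n : ℝ) + 1) with hu
  have hu0 : ∀ n, 0 < u n := fun n => by simp only [hu]; positivity
  set s : ℕ → Set ℝ := fun n => Set.Ioc (u n) (n + 1) with hs
  have hmono : Monotone s := by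
    intro m n hmn
    have : (m : ℝ) ≤ n := by exact_mod_cast hmn
    exact Set.Ioc_subset_Ioc (one_div_le_one_div_of_le (by positivity) (by linarith)) (by linarith)
  have hU : ⋃ n, s n = Set.Ioi 0 := by
    ext x
    simp only [Set.mem_iUnion, Set.mem_Ioi]
    constructor
    · rintro ⟨n, hn⟩; exact (hu0 n).trans hn.1
    · intro hx
      obtain ⟨m, hm⟩ := exists_nat_one_div_lt hx
      obtain ⟨n, hn⟩ := exists_nat_ge x
      refine ⟨max m n, ?_⟩
      have h1 : (m : ℝ) ≤ (max m n : ℕ) := by exact_mod_cast le_max_left m n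
      have h2 : (n : ℝ) ≤ (max m n : ℕ) := by exact_mod_cast le_max_right m n
      exact ⟨lt_of_le_of_lt (one_div_le_one_div_of_le (by positivity) (by linarith)) hm,
        by linarith⟩
  have hut : Tendsto u atTop (𝓝 0) := tendsto_one_div_add_atTop_nhds_zero_nat
  have hA : Tendsto (fun n => ∫⁻ t in Set.Ioc 0 (u n), ‖f t‖ₑ ^ p) atTop (𝓝 0) := by
    have h1 : Tendsto (fun n => volume.restrict (Set.Ioi 0) (Set.Ioc 0 (u n))) atTop (𝓝 0) := by
      refine tendsto_of_tendsto_of_tendsto_of_le_of_le tendsto_const_nhds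
        (h := fun n => ENNReal.ofReal (u n)) ?_ (fun n => bot_le) (fun n => ?_)
      · have := (ENNReal.continuous_ofReal.tendsto 0).comp hut
        rwa [ENNReal.ofReal_zero] at this
      · refine (Measure.restrict_apply_le _ _).trans ?_
        simp
    have h2 := tendsto_setLIntegral_zero hfin h1
    refine h2.congr fun n => ?_
    rw [Measure.restrict_restrict measurableSet_Ioc,
      Set.inter_eq_left.2 Set.Ioc_subset_Ioi_self]
  have hlim : Tendsto (fun n => ENNReal.ofReal K * (∫⁻ t in Set.Ioi 0, ‖f t‖ₑ ^ p) +
      ENNReal.ofReal c * ∫⁻ t in Set.Ioc 0 (u n), ‖f t‖ₑ ^ p) atTop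
      (𝓝 (ENNReal.ofReal K * ∫⁻ t in Set.Ioi 0, ‖f t‖ₑ ^ p)) := by
    have := (ENNReal.Tendsto.const_mul hA (Or.inr ENNReal.ofReal_ne_top) (a := ENNReal.ofReal c))
    simpa only [mul_zero, add_zero] using
      this.const_add (ENNReal.ofReal K * ∫⁻ t in Set.Ioi 0, ‖f t‖ₑ ^ p)
  rw [← hU, setLIntegral_iUnion_of_directed _ hmono.directed_le, hU]
  refine iSup_le fun n => ?_
  -- enlarging the interval only increases the left-hand side, so the limit bounds every term
  refine ge_of_tendsto hlim ?_
  filter_upwards [eventually_ge_atTop n] with k hk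
  refine (lintegral_mono_set (hmono hk)).trans ?_
  have huk : u k ≤ k + 1 := by
    have h1 : u k ≤ 1 := by
      simp only [hu]; rw [div_le_one (by positivity)]; linarith [Nat.cast_nonneg (α := ℝ) k]
    linarith [Nat.cast_nonneg (α := ℝ) k]
  refine (lintegral_sub_hardy_le_of_pos hp hK hc h hf (hu0 k) huk).trans ?_
  gcongr
  rw [ENNReal.ofReal_mul hc]
  gcongr
  exact hardy_energy_le hp hf (hu0 k)

/-! ### Polar coordinates and radial functions -/

/-- Lebesgue measure on the parameter rectangle `(0, ∞) × (-π, π)` of polar coordinates. -/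
noncomputable abbrev polarMeasure : Measure (ℝ × ℝ) :=
  (volume.restrict (Set.Ioi 0)).prod (volume.restrict (Set.Ioo (-Real.pi) Real.pi))

lemma volume_restrict_polarCoord_target :
    (volume : Measure (ℝ × ℝ)).restrict polarCoord.target = polarMeasure :=
  (Measure.prod_restrict _ _).symm

lemma polarCoord_symm_eq_circleMap (p : ℝ × ℝ) :
    Complex.polarCoord.symm p = circleMap 0 p.1 p.2 := by
  rw [Complex.polarCoord_symm_apply, circleMap_zero, Complex.exp_mul_I]
  push_cast; ring

lemma measurable_circleMap_prod : Measurable fun p : ℝ × ℝ => circleMap 0 p.1 p.2 :=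
  Continuous.measurable (by unfold circleMap; fun_prop)

lemma lintegral_polarMeasure (φ : ℂ → ENNReal) :
    ∫⁻ p, ENNReal.ofReal p.1 * φ (circleMap 0 p.1 p.2) ∂polarMeasure = ∫⁻ w, φ w := by
  rw [← Complex.lintegral_comp_polarCoord_symm φ, volume_restrict_polarCoord_target]
  simp only [polarCoord_symm_eq_circleMap, smul_eq_mul]

lemma lintegral_polar {φ : ℂ → ENNReal} (hφ : Measurable φ) :
    ∫⁻ w, φ w = ∫⁻ r in Set.Ioi 0, ENNReal.ofReal r *
      ∫⁻ θ in Set.Ioo (-Real.pi) Real.pi, φ (circleMap 0 r θ) := by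
  have hm := measurable_circleMap_prod
  rw [← lintegral_polarMeasure, lintegral_prod _ (by fun_prop)]
  refine lintegral_congr fun r => ?_
  have hmr : Measurable fun θ => φ (circleMap 0 r θ) :=
    hφ.comp (hm.comp (by fun_prop : Measurable fun θ : ℝ => (r, θ)))
  dsimp only
  rw [lintegral_const_mul _ hmr]

lemma integrable_polar {φ : ℂ → ℂ} (hφ : Measurable φ) (hi : Integrable φ) :
    Integrable (fun p : ℝ × ℝ => p.1 • φ (circleMap 0 p.1 p.2)) polarMeasure := by
  have hm := measurable_circleMap_prod
  refine ⟨(measurable_fst.smul (hφ.comp hm)).aestronglyMeasurable, ?_⟩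
  refine lt_of_le_of_lt (le_of_eq ?_) hi.2
  rw [← lintegral_polarMeasure, ← volume_restrict_polarCoord_target]
  refine setLIntegral_congr_fun polarCoord.open_target.measurableSet fun p hp => ?_
  have : 0 < p.1 := hp.1
  simp only [enorm_smul]
  rw [Real.enorm_eq_ofReal this.le]

lemma integral_polarMeasure (φ : ℂ → ℂ) :
    ∫ p, p.1 • φ (circleMap 0 p.1 p.2) ∂polarMeasure = ∫ w, φ w := by
  rw [← Complex.integral_comp_polarCoord_symm φ, volume_restrict_polarCoord_target]
  simp only [polarCoord_symm_eq_circleMap]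

lemma integral_polar {φ : ℂ → ℂ} (hφ : Measurable φ) (hi : Integrable φ) :
    ∫ w, φ w = ∫ r in Set.Ioi (0 : ℝ), r •
      ∫ θ in Set.Ioo (-Real.pi) Real.pi, φ (circleMap 0 r θ) := by
  rw [← integral_polarMeasure, integral_prod _ (integrable_polar hφ hi)]
  simp only [integral_smul]

lemma integral_polar_symm {φ : ℂ → ℂ} (hφ : Measurable φ) (hi : Integrable φ) :
    ∫ w, φ w = ∫ θ in Set.Ioo (-Real.pi) Real.pi, ∫ r in Set.Ioi (0 : ℝ),
      r • φ (circleMap 0 r θ) := by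
  rw [← integral_polarMeasure, integral_prod_symm _ (integrable_polar hφ hi)]

/-- The image of Lebesgue measure on `ℂ` under `z ↦ |z|^2` is `π` times Lebesgue measure on the
positive half line. -/
lemma map_norm_sq : (volume : Measure ℂ).map (fun z => ‖z‖ ^ 2) =
    NNReal.pi • volume.restrict (Set.Ioi (0 : ℝ)) := by
  symm
  refine Real.measure_ext_Ioo_rat fun a b => ?_
  generalize (a : ℝ) = a
  generalize (b : ℝ) = b
  rw [Measure.map_apply (by fun_prop) measurableSet_Ioo, Measure.smul_apply,
    Measure.restrict_apply measurableSet_Ioo]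
  have hI : Set.Ioo a b ∩ Set.Ioi 0 = Set.Ioo (max a 0) b := by
    rw [Set.Ioo_inter_Ioi]
  rw [hI, Real.volume_Ioo]
  have hnull : volume ({0} : Set ℂ) = 0 := by simp
  rcases le_or_gt b (max a 0) with hb | hb
  · rw [ENNReal.ofReal_of_nonpos (by linarith), smul_zero]
    symm
    refine measure_mono_null (fun z hz => ?_) hnull
    exfalso
    have h1 : a < ‖z‖ ^ 2 := hz.1
    have h2 : ‖z‖ ^ 2 < b := hz.2
    have : max a 0 ≤ ‖z‖ ^ 2 := max_le h1.le (sq_nonneg _)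
    linarith
  · set c := max a 0 with hc
    have hc0 : 0 ≤ c := le_max_right _ _
    have hb0 : 0 ≤ b := hc0.trans hb.le
    -- up to the origin, the preimage is an annulus
    have e : (fun z : ℂ => ‖z‖ ^ 2) ⁻¹' Set.Ioo a b =ᵐ[volume]
        (Metric.ball (0 : ℂ) (√b) \ Metric.closedBall 0 (√c) : Set ℂ) := by
      have h0 : ∀ᵐ z : ℂ, z ≠ 0 := by simp [ae_iff]
      filter_upwards [h0] with z hz
      have hzp : 0 < ‖z‖ := norm_pos_iff.2 hz
      apply propext
      change (a < ‖z‖ ^ 2 ∧ ‖z‖ ^ 2 < b) ↔ (dist z 0 < √b ∧ ¬ dist z 0 ≤ √c)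
      rw [dist_zero_right, not_le, Real.lt_sqrt hzp.le, Real.sqrt_lt' hzp, hc, max_lt_iff]
      have : 0 < ‖z‖ ^ 2 := by positivity
      tauto
    rw [measure_congr e, measure_sdiff (Metric.closedBall_subset_ball (Real.sqrt_lt_sqrt hc0 hb))
      Metric.isClosed_closedBall.measurableSet.nullMeasurableSet measure_closedBall_lt_top.ne,
      Complex.volume_ball, Complex.volume_closedBall, ← ENNReal.ofReal_pow (Real.sqrt_nonneg _),
      ← ENNReal.ofReal_pow (Real.sqrt_nonneg _), Real.sq_sqrt hb0, Real.sq_sqrt hc0,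
      ← ENNReal.sub_mul (fun _ _ => ENNReal.coe_ne_top), ← ENNReal.ofReal_sub _ hc0, mul_comm]
    rfl

lemma ae_norm_sq {P : ℝ → Prop} (h : ∀ᵐ s ∂volume.restrict (Set.Ioi (0 : ℝ)), P s) :
    ∀ᵐ z : ℂ, P (‖z‖ ^ 2) := by
  have h1 : ∀ᵐ s ∂(volume : Measure ℂ).map (fun z => ‖z‖ ^ 2), P s := by
    rw [map_norm_sq]
    exact Measure.ae_smul_measure h _
  exact ae_of_ae_map (by fun_prop) h1

lemma eLpNorm_comp_norm_sq {g : ℝ → ℂ} {q : ENNReal}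
    (hg : AEStronglyMeasurable g (volume.restrict (Set.Ioi (0 : ℝ)))) :
    eLpNorm (fun z : ℂ => g (‖z‖ ^ 2)) q volume =
      NNReal.pi ^ q.toReal⁻¹ • eLpNorm g q (volume.restrict (Set.Ioi 0)) := by
  have hpi : NNReal.pi ≠ 0 := NNReal.pi_ne_zero
  rw [← eLpNorm_smul_measure_of_ne_zero' hpi, ← map_norm_sq,
    eLpNorm_map_measure _ (by fun_prop)]
  · rfl
  · rw [map_norm_sq]
    exact hg.smul_measure _

lemma integral_comp_norm_sq {g : ℝ → ℂ} (hg : Measurable g) :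
    ∫ z : ℂ, g (‖z‖ ^ 2) = Real.pi * ∫ s in Set.Ioi (0 : ℝ), g s := by
  have := integral_map (μ := (volume : Measure ℂ)) (φ := fun z => ‖z‖ ^ 2) (f := g)
    (by fun_prop) hg.aestronglyMeasurable
  rw [← this, map_norm_sq, integral_smul_nnreal_measure]
  simp [NNReal.smul_def]

lemma lintegral_comp_norm_sq {g : ℝ → ENNReal} (hg : Measurable g) :
    ∫⁻ z : ℂ, g (‖z‖ ^ 2) = NNReal.pi * ∫⁻ s in Set.Ioi (0 : ℝ), g s := by
  have := lintegral_map (μ := (volume : Measure ℂ)) hg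
    (by fun_prop : Measurable fun z : ℂ => ‖z‖ ^ 2)
  rw [← this, map_norm_sq, lintegral_smul_measure]
  rfl

/-- A measurable radial function has a Borel profile: restrict a Borel representative to a generic
ray. -/
lemma IsRadial.exists_measurable_profile {F : ℂ → ℂ} (hr : IsRadial F)
    (hF : AEStronglyMeasurable F volume) :
    ∃ f : ℝ → ℂ, Measurable f ∧ F =ᵐ[volume] fun z => f (‖z‖ ^ 2) := by
  obtain ⟨f₀, hf₀⟩ := hr
  obtain ⟨F', hF', hFF'⟩ := hF.aemeasurable
  have h0 : ∀ᵐ z : ℂ, F' z = f₀ (‖z‖ ^ 2) := by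
    filter_upwards [hf₀, hFF'] with z h1 h2
    rw [← h2, h1]
  have h1 : ∀ᵐ p ∂polarMeasure, F' (circleMap 0 p.1 p.2) = f₀ (p.1 ^ 2) := by
    set N := toMeasurable volume {z : ℂ | ¬ F' z = f₀ (‖z‖ ^ 2)} with hN
    have hN0 : volume N = 0 := by rw [hN, measure_toMeasurable]; exact h0
    have hNm : MeasurableSet N := measurableSet_toMeasurable _ _
    have hl := lintegral_polarMeasure (N.indicator 1)
    rw [lintegral_indicator_one hNm, hN0, lintegral_eq_zero_iff] at hl
    · rw [← volume_restrict_polarCoord_target] at hl ⊢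
      filter_upwards [hl, ae_restrict_mem polarCoord.open_target.measurableSet] with p hp hpt
      have hp0 : 0 < p.1 := hpt.1
      by_contra hcon
      have hmem : circleMap 0 p.1 p.2 ∈ N := by
        refine subset_toMeasurable _ _ ?_
        change ¬ F' (circleMap 0 p.1 p.2) = f₀ (‖circleMap 0 p.1 p.2‖ ^ 2)
        rwa [norm_circleMap_zero, sq_abs]
      simp only [Pi.zero_apply, Set.indicator_of_mem hmem, Pi.one_apply, mul_one,
        ENNReal.ofReal_eq_zero] at hp
      linarith
    · have hm := measurable_circleMap_prod
      exact (by fun_prop : Measurable fun p : ℝ × ℝ => ENNReal.ofReal p.1).mul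
        ((measurable_one.indicator hNm).comp hm)
  have h2 := Measure.ae_ae_of_ae_prod (Measure.measurePreserving_swap.quasiMeasurePreserving.ae h1)
  have hne : (ae ((volume : Measure ℝ).restrict (Set.Ioo (-Real.pi) Real.pi))).NeBot := by
    rw [ae_restrict_neBot, Real.volume_Ioo]
    simp [Real.pi_pos]
  obtain ⟨θ, hθ⟩ := h2.exists
  simp only [Prod.swap_prod_mk] at hθ
  refine ⟨fun s => F' (circleMap 0 (√s) θ), ?_, ?_⟩
  · have hm := measurable_circleMap_prod
    exact hF'.comp (hm.comp (by fun_prop : Measurable fun s : ℝ => (√s, θ)))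
  · have h3 : ∀ᵐ s ∂volume.restrict (Set.Ioi (0 : ℝ)), F' (circleMap 0 (√s) θ) = f₀ s := by
      rw [ae_restrict_iff' measurableSet_Ioi] at hθ ⊢
      rw [ae_iff] at hθ ⊢
      refine measure_mono_null ?_ (addHaar_image_eq_zero_of_differentiableOn_of_addHaar_eq_zero
        volume (f := fun r : ℝ => r ^ 2) (by fun_prop) hθ)
      intro s hs
      simp only [Set.mem_ofPred_eq, Set.mem_Ioi, Classical.not_imp] at hs
      refine ⟨√s, ?_, Real.sq_sqrt hs.1.le⟩
      simp only [Set.mem_ofPred_eq, Set.mem_Ioi, Classical.not_imp]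
      rw [Real.sq_sqrt hs.1.le]
      exact ⟨Real.sqrt_pos.2 hs.1, hs.2⟩
    filter_upwards [hFF', h0, ae_norm_sq h3] with z e1 e2 e3
    rw [e1, e2, ← e3]

/-! ### Circle averages of the kernel -/

lemma setIntegral_circleMap (k : ℂ → ℂ) (r : ℝ) :
    ∫ θ in Set.Ioo (-Real.pi) Real.pi, k (circleMap 0 r θ) =
      2 * Real.pi * Real.circleAverage k 0 r := by
  have hper : Function.Periodic (fun θ => k (circleMap 0 r θ)) (2 * Real.pi) := fun θ => by
    simp [periodic_circleMap 0 r θ]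
  have h := hper.intervalIntegral_add_eq (-Real.pi) 0
  rw [show -Real.pi + 2 * Real.pi = Real.pi by ring, zero_add,
    intervalIntegral.integral_of_le (by linarith [Real.pi_pos]), integral_Ioc_eq_integral_Ioo] at h
  rw [h, Real.circleAverage_def, Complex.real_smul]
  have : (Real.pi : ℂ) ≠ 0 := by exact_mod_cast Real.pi_ne_zero
  push_cast
  field_simp

lemma circleAverage_kernel_of_lt {z : ℂ} {r : ℝ} (hr : 0 ≤ r) (h : r < ‖z‖) :
    Real.circleAverage (fun w => 1 / (z - w) ^ 2) 0 r = 1 / z ^ 2 := by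
  have hne : ∀ w ∈ Metric.closedBall (0 : ℂ) |r|, (z - w) ^ 2 ≠ 0 := by
    intro w hw h0
    rw [mem_closedBall_zero_iff, abs_of_nonneg hr] at hw
    rw [sq_eq_zero_iff, sub_eq_zero] at h0
    rw [← h0] at hw
    linarith
  rw [DiffContOnCl.circleAverage, sub_zero]
  apply DifferentiableOn.diffContOnCl
  intro w hw
  have := hne w (Metric.closure_ball_subset_closedBall hw)
  exact DifferentiableAt.differentiableWithinAt (by fun_prop (disch := assumption))

/-- On the unit circle `w ↦ w⁻¹` turns the kernel into `w ^ 2 / (z w - r) ^ 2`, which is holomorphic in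
the disc and vanishes at the origin. -/
lemma circleAverage_kernel_of_gt {z : ℂ} {r : ℝ} (h : ‖z‖ < r) :
    Real.circleAverage (fun w => 1 / (z - w) ^ 2) 0 r = 0 := by
  have hr : 0 < r := (norm_nonneg z).trans_lt h
  rw [Real.circleAverage_eq_circleAverage_zero_one, ← Real.circleAverage_zero_one_congr_inv]
  have hc : Real.circleAverage (fun w : ℂ => 1 / (z - (r * w⁻¹ + 0)) ^ 2) 0 1 =
      Real.circleAverage (fun w : ℂ => w ^ 2 / (z * w - r) ^ 2) 0 1 := by
    apply Real.circleAverage_congr_sphere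
    intro w hw
    have hw0 : w ≠ 0 := by
      rintro rfl
      simp at hw
    simp only
    rw [show z - (r * w⁻¹ + 0) = (z * w - r) / w by field_simp; ring, div_pow, one_div_div]
  rw [hc, DiffContOnCl.circleAverage]
  · simp
  apply DifferentiableOn.diffContOnCl
  intro w hw
  have hw1 : ‖w‖ ≤ 1 := by
    have := Metric.closure_ball_subset_closedBall hw
    simpa using this
  have : (z * w - r) ^ 2 ≠ 0 := by
    intro h0
    rw [sq_eq_zero_iff, sub_eq_zero] at h0
    have h1 := congrArg norm h0
    rw [norm_mul, Complex.norm_real, Real.norm_of_nonneg hr.le] at h1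
    nlinarith [norm_nonneg z]
  exact DifferentiableAt.differentiableWithinAt (by fun_prop (disch := assumption))

/-! ### Truncated integrals of radial functions -/

/-- A kernel with constant means on circles acts on radial functions through that mean. The right-hand
side is the integral of `h(‖w‖ ^ 2)` over the same set in polar coordinates, and is meaningful without
assuming that integral to converge. -/
lemma integral_radial_mul {h : ℝ → ℂ} {k : ℂ → ℂ} {A : Set ℝ} {c : ℂ} (hh : Measurable h)
    (hk : Measurable k) (hA : MeasurableSet A)
    (hc : ∀ r, 0 < r → r ∈ A → Real.circleAverage k 0 r = c)
    (hi : IntegrableOn (fun w => h (‖w‖ ^ 2) * k w) {w : ℂ | ‖w‖ ∈ A}) :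
    ∫ w in {w : ℂ | ‖w‖ ∈ A}, h (‖w‖ ^ 2) * k w =
      c * ∫ r in Set.Ioi (0 : ℝ), r • (2 * Real.pi * A.indicator (fun r => h (r ^ 2)) r) := by
  have hS : MeasurableSet {w : ℂ | ‖w‖ ∈ A} := measurable_norm hA
  have hm : Measurable (fun w : ℂ => h (‖w‖ ^ 2) * k w) := by fun_prop
  rw [← integral_indicator hS, integral_polar (hm.indicator hS) (hi.integrable_indicator hS),
    ← integral_const_mul]
  refine setIntegral_congr_fun measurableSet_Ioi fun r hr => ?_
  have hr0 : 0 < r := hr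
  by_cases hrA : r ∈ A
  · have e : ∀ θ, {w : ℂ | ‖w‖ ∈ A}.indicator (fun w => h (‖w‖ ^ 2) * k w) (circleMap 0 r θ) =
        h (r ^ 2) * k (circleMap 0 r θ) := fun θ => by
      have hn : ‖circleMap 0 r θ‖ = r := by rw [norm_circleMap_zero, abs_of_pos hr0]
      have : circleMap 0 r θ ∈ {w : ℂ | ‖w‖ ∈ A} := by
        change ‖circleMap 0 r θ‖ ∈ A
        rwa [hn]
      rw [Set.indicator_of_mem this, hn]
    simp only [e]
    rw [integral_const_mul, setIntegral_circleMap, hc r hr0 hrA, Set.indicator_of_mem hrA]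
    simp only [Complex.real_smul]; ring
  · have e : ∀ θ, {w : ℂ | ‖w‖ ∈ A}.indicator (fun w => h (‖w‖ ^ 2) * k w) (circleMap 0 r θ) =
        0 := fun θ => by
      have hn : ‖circleMap 0 r θ‖ = r := by rw [norm_circleMap_zero, abs_of_pos hr0]
      have : circleMap 0 r θ ∉ {w : ℂ | ‖w‖ ∈ A} := by
        change ¬ ‖circleMap 0 r θ‖ ∈ A
        rwa [hn]
      rw [Set.indicator_of_notMem this]
    simp [e, hrA]

lemma integral_inside {h : ℝ → ℂ} (hh : Measurable h) {z : ℂ} {ρ : ℝ} (hρ0 : 0 ≤ ρ) (hρ : ρ < ‖z‖)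
    (hi : IntegrableOn (fun w : ℂ => h (‖w‖ ^ 2)) {w | ‖w‖ < ρ})
    (hik : IntegrableOn (fun w : ℂ => h (‖w‖ ^ 2) * (1 / (z - w) ^ 2)) {w | ‖w‖ < ρ}) :
    ∫ w in {w : ℂ | ‖w‖ < ρ}, h (‖w‖ ^ 2) * (1 / (z - w) ^ 2) =
      Real.pi / z ^ 2 * ∫ s in (0 : ℝ)..ρ ^ 2, h s := by
  have e1 := integral_radial_mul (A := Set.Iio ρ) (c := 1 / z ^ 2) hh
    (by fun_prop : Measurable fun w : ℂ => 1 / (z - w) ^ 2) measurableSet_Iio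
    (fun r hr hrA => circleAverage_kernel_of_lt hr.le ((Set.mem_Iio.1 hrA).trans hρ)) hik
  have e2 := integral_radial_mul (A := Set.Iio ρ) (c := 1) (k := fun _ => 1) hh
    measurable_const measurableSet_Iio (fun r _ _ => Real.circleAverage_const _ _ _)
    (by simpa using hi)
  simp only [Set.mem_Iio, mul_one, one_mul] at e1 e2
  rw [e1, ← e2]
  have e3 : ∫ w in {w : ℂ | ‖w‖ < ρ}, h (‖w‖ ^ 2) =
      ∫ w : ℂ, (Set.Iio (ρ ^ 2)).indicator h (‖w‖ ^ 2) := by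
    rw [← integral_indicator (measurableSet_lt measurable_norm measurable_const)]
    congr 1
    ext w
    have : ‖w‖ < ρ ↔ ‖w‖ ^ 2 < ρ ^ 2 := (pow_lt_pow_iff_left₀ (norm_nonneg _) hρ0 two_ne_zero).symm
    by_cases hw : ‖w‖ < ρ
    · rw [Set.indicator_of_mem (show w ∈ {w : ℂ | ‖w‖ < ρ} from hw),
        Set.indicator_of_mem (show ‖w‖ ^ 2 ∈ Set.Iio (ρ ^ 2) from this.1 hw)]
    · rw [Set.indicator_of_notMem (show w ∉ {w : ℂ | ‖w‖ < ρ} from hw),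
        Set.indicator_of_notMem (show ‖w‖ ^ 2 ∉ Set.Iio (ρ ^ 2) from fun h => hw (this.2 h))]
  rw [e3, integral_comp_norm_sq (hh.indicator measurableSet_Iio),
    setIntegral_indicator measurableSet_Iio, intervalIntegral.integral_of_le (sq_nonneg ρ),
    Set.Ioi_inter_Iio, integral_Ioc_eq_integral_Ioo]
  ring

lemma integral_outside {h : ℝ → ℂ} (hh : Measurable h) {z : ℂ} {ρ : ℝ} (hρ : ‖z‖ < ρ)
    (hik : IntegrableOn (fun w : ℂ => h (‖w‖ ^ 2) * (1 / (z - w) ^ 2)) {w | ρ < ‖w‖}) :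
    ∫ w in {w : ℂ | ρ < ‖w‖}, h (‖w‖ ^ 2) * (1 / (z - w) ^ 2) = 0 := by
  have e1 := integral_radial_mul (A := Set.Ioi ρ) (c := 0) hh
    (by fun_prop : Measurable fun w : ℂ => 1 / (z - w) ^ 2) measurableSet_Ioi
    (fun r _ hrA => circleAverage_kernel_of_gt (hρ.trans (Set.mem_Ioi.1 hrA))) hik
  simpa only [Set.mem_Ioi, zero_mul] using e1

/-! ### The annulus around the singularity -/

lemma lintegral_two_div_add_sq {ε b : ℝ} (hε : 0 < ε) (hb : 0 < b) :
    ∫⁻ θ : ℝ, ENNReal.ofReal (2 / (ε ^ 2 + b ^ 2 * θ ^ 2)) =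
      ENNReal.ofReal (2 * Real.pi / (ε * b)) := by
  have e : ∀ θ : ℝ, 2 / (ε ^ 2 + b ^ 2 * θ ^ 2) = 2 / ε ^ 2 * (1 + (b / ε * θ) ^ 2)⁻¹ := fun θ => by
    have : 0 < ε ^ 2 + b ^ 2 * θ ^ 2 := by positivity
    have h2 : (1 + (b / ε * θ) ^ 2) = (ε ^ 2 + b ^ 2 * θ ^ 2) / ε ^ 2 := by field_simp
    rw [h2]; field_simp
  have hbe : b / ε ≠ 0 := by positivity
  have hint : Integrable fun θ : ℝ => 2 / ε ^ 2 * (1 + (b / ε * θ) ^ 2)⁻¹ :=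
    (integrable_inv_one_add_sq.comp_mul_left' hbe).const_mul _
  simp only [e]
  rw [← ofReal_integral_eq_lintegral_ofReal hint
    (Eventually.of_forall fun θ => by positivity), integral_const_mul,
    Measure.integral_comp_mul_left (fun x : ℝ => (1 + x ^ 2)⁻¹), integral_univ_inv_one_add_sq,
    abs_of_pos (by positivity)]
  congr 1
  simp only [smul_eq_mul]
  field_simp

/-- Away from the disc of radius `ε` around `R`, the kernel on the circle of radius `r ≥ R / 2` is
dominated by a Cauchy density in the angle. -/
lemma enorm_kernel_le {R r ε θ : ℝ} (hR : 0 < R) (hr : R / 2 ≤ r) (hε : 0 < ε)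
    (hθ : θ ∈ Set.Ioo (-Real.pi) Real.pi) (h : ε < ‖(R : ℂ) - circleMap 0 r θ‖) :
    ‖1 / ((R : ℂ) - circleMap 0 r θ) ^ 2‖ₑ ≤
      ENNReal.ofReal (2 / (ε ^ 2 + (R / 3) ^ 2 * θ ^ 2)) := by
  have hsq : ‖(R : ℂ) - circleMap 0 r θ‖ ^ 2 = (R - r) ^ 2 + 4 * R * r * Real.sin (θ / 2) ^ 2 := by
    have hc : Real.cos θ = 1 - 2 * Real.sin (θ / 2) ^ 2 := by
      rw [show θ = 2 * (θ / 2) by ring, Real.cos_two_mul', Real.cos_sq']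
      ring_nf
    rw [← Complex.normSq_eq_norm_sq, Complex.normSq_apply, circleMap_zero]
    simp only [Complex.sub_re, Complex.sub_im, Complex.ofReal_re, Complex.ofReal_im,
      Complex.re_ofReal_mul, Complex.im_ofReal_mul, Complex.exp_ofReal_mul_I_re,
      Complex.exp_ofReal_mul_I_im]
    have := Real.sin_sq_add_cos_sq θ
    linear_combination r ^ 2 * this - 2 * R * r * hc
  have hsin : θ ^ 2 / Real.pi ^ 2 ≤ Real.sin (θ / 2) ^ 2 := by
    have key : ∀ t : ℝ, 0 ≤ t → t < Real.pi → t ^ 2 / Real.pi ^ 2 ≤ Real.sin (t / 2) ^ 2 := by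
      intro t ht ht'
      have := Real.mul_le_sin (x := t / 2) (by linarith) (by linarith)
      have e : 2 / Real.pi * (t / 2) = t / Real.pi := by ring
      rw [e] at this
      rw [← div_pow]
      exact pow_le_pow_left₀ (by positivity) this 2
    rcases le_total 0 θ with h0 | h0
    · exact key θ h0 hθ.2
    · have := key (-θ) (by linarith) (by linarith [hθ.1])
      rwa [neg_sq, neg_div, Real.sin_neg, neg_sq] at this
  have hlow : (R / 3) ^ 2 * θ ^ 2 ≤ ‖(R : ℂ) - circleMap 0 r θ‖ ^ 2 := by
    rw [hsq]
    have hpi : Real.pi ^ 2 ≤ 16 := by nlinarith [Real.pi_le_four, Real.pi_pos]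
    have h1 : θ ^ 2 / 16 ≤ Real.sin (θ / 2) ^ 2 :=
      (div_le_div_of_nonneg_left (sq_nonneg _) (by positivity) hpi).trans hsin
    have h2 : 2 * R ^ 2 * (θ ^ 2 / 16) ≤ 4 * R * r * Real.sin (θ / 2) ^ 2 := by
      apply mul_le_mul _ h1 (by positivity) (by nlinarith)
      nlinarith
    nlinarith [sq_nonneg (R - r), mul_nonneg (sq_nonneg R) (sq_nonneg θ)]
  have hε2 : ε ^ 2 < ‖(R : ℂ) - circleMap 0 r θ‖ ^ 2 := pow_lt_pow_left₀ h hε.le two_ne_zero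
  rw [← ofReal_norm]
  apply ENNReal.ofReal_le_ofReal
  rw [norm_div, norm_one, norm_pow]
  rw [div_le_div_iff₀ (by nlinarith [sq_nonneg ε]) (by positivity)]
  linarith

/-- The bound on the annulus around the singularity. It has the form of an average over an interval of
length comparable to `‖z‖ ε` around `‖z‖ ^ 2`, which is small at Lebesgue points. -/
lemma lintegral_annulus_le {h : ℝ → ℂ} (hh : Measurable h) {z : ℂ} {ε : ℝ} (hε : 0 < ε)
    (hεz : ε ≤ ‖z‖ / 2) :
    ∫⁻ w in {w : ℂ | ‖z‖ - ε ≤ ‖w‖ ∧ ‖w‖ ≤ ‖z‖ + ε ∧ ε < ‖z - w‖},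
        ‖h (‖w‖ ^ 2) * (1 / (z - w) ^ 2)‖ₑ ≤
      ENNReal.ofReal (3 * Real.pi / (ε * ‖z‖)) *
        ∫⁻ s in Metric.closedBall (‖z‖ ^ 2) (3 * ‖z‖ * ε), ‖h s‖ₑ := by
  set R := ‖z‖ with hR
  have hR0 : 0 < R := by linarith
  have hz : z ≠ 0 := norm_pos_iff.1 hR0
  set S : Set ℂ := {w : ℂ | R - ε ≤ ‖w‖ ∧ ‖w‖ ≤ R + ε ∧ ε < ‖z - w‖} with hS
  have hSm : MeasurableSet S :=
    (measurableSet_le measurable_const measurable_norm).inter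
      ((measurableSet_le measurable_norm measurable_const).inter
        (measurableSet_lt measurable_const (by fun_prop : Measurable fun w : ℂ => ‖z - w‖)))
  set T : Set ℝ := Set.Icc (R - ε) (R + ε) with hT
  set φ : ℂ → ENNReal := S.indicator fun w => ‖h (‖w‖ ^ 2) * (1 / (z - w) ^ 2)‖ₑ with hφ
  have hφm : Measurable φ := Measurable.indicator (by fun_prop) hSm
  -- rotate so that `z` becomes the positive real number `R`
  obtain ⟨u, hu⟩ : ∃ u : Circle, (u : ℂ) = z / R := ⟨⟨z / R, mem_sphere_zero_iff_norm.2 (by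
    rw [norm_div, Complex.norm_real, Real.norm_of_nonneg hR0.le, ← hR, div_self hR0.ne'])⟩, rfl⟩
  have hrot : ∫⁻ w, φ w = ∫⁻ w, φ (u * w) :=
    ((rotation u).measurePreserving.lintegral_comp hφm).symm
  have huw : ∀ w : ℂ, ‖(u : ℂ) * w‖ = ‖w‖ := fun w => by
    rw [norm_mul, Circle.norm_coe, one_mul]
  have hRC : (R : ℂ) ≠ 0 := by exact_mod_cast hR0.ne'
  have hzu : ∀ w : ℂ, z - u * w = u * (R - w) := fun w => by
    have : z = u * R := by rw [hu]; field_simp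
    rw [mul_sub, ← this]
  have hbound : ∀ r, 0 < r → ∫⁻ θ in Set.Ioo (-Real.pi) Real.pi, φ (u * circleMap 0 r θ) ≤
      T.indicator (fun r => ‖h (r ^ 2)‖ₑ) r * ENNReal.ofReal (2 * Real.pi / (ε * (R / 3))) := by
    intro r hr
    have hn : ∀ θ, ‖circleMap 0 r θ‖ = r := fun θ => by rw [norm_circleMap_zero, abs_of_pos hr]
    by_cases hrT : r ∈ T
    · rw [Set.indicator_of_mem hrT, ← lintegral_two_div_add_sq hε (by positivity),
        ← lintegral_const_mul' _ _ enorm_ne_top]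
      refine le_trans ?_ (setLIntegral_le_lintegral (Set.Ioo (-Real.pi) Real.pi) _)
      refine setLIntegral_mono' measurableSet_Ioo fun θ hθ => ?_
      simp only [hφ]
      by_cases hmem : (u : ℂ) * circleMap 0 r θ ∈ S
      · rw [Set.indicator_of_mem hmem, enorm_mul, huw, hn]
        gcongr
        have h3 := hmem.2.2
        rw [hzu, norm_mul, Circle.norm_coe, one_mul] at h3
        refine le_trans (le_of_eq ?_) (enorm_kernel_le hR0 (by linarith [hrT.1]) hε hθ h3)
        rw [hzu, mul_pow, ← ofReal_norm, ← ofReal_norm, norm_div, norm_div, norm_mul, norm_pow,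
          Circle.norm_coe, one_pow, one_mul]
      · rw [Set.indicator_of_notMem hmem]
        exact zero_le
    · refine le_of_eq_of_le (lintegral_eq_zero_of_ae_eq_zero
        (Eventually.of_forall fun θ => ?_)) zero_le
      refine Set.indicator_of_notMem (fun hmem => hrT ?_) _
      have h1 := hmem.1
      have h2 := hmem.2.1
      rw [huw, hn] at h1 h2
      exact ⟨h1, h2⟩
  have hpolar : ∫⁻ w : ℂ, T.indicator (fun r => ‖h (r ^ 2)‖ₑ) ‖w‖ =
      ∫⁻ r in Set.Ioi (0 : ℝ), ENNReal.ofReal r *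
        (T.indicator (fun r => ‖h (r ^ 2)‖ₑ) r * ENNReal.ofReal (2 * Real.pi)) := by
    have hm : Measurable (T.indicator (fun r => ‖h (r ^ 2)‖ₑ)) :=
      Measurable.indicator (by fun_prop) measurableSet_Icc
    rw [lintegral_polar (φ := fun w => T.indicator (fun r => ‖h (r ^ 2)‖ₑ) ‖w‖)
      (hm.comp measurable_norm)]
    refine setLIntegral_congr_fun measurableSet_Ioi fun r hr => ?_
    have hr0 : 0 < r := hr
    simp only [norm_circleMap_zero, abs_of_pos hr0, lintegral_const, Measure.restrict_apply_univ,
      Real.volume_Ioo]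
    rw [show Real.pi - -Real.pi = 2 * Real.pi by ring]
  have hsub : ∀ w : ℂ, T.indicator (fun r => ‖h (r ^ 2)‖ₑ) ‖w‖ ≤
      (Metric.closedBall (R ^ 2) (3 * R * ε)).indicator (fun s => ‖h s‖ₑ) (‖w‖ ^ 2) := by
    intro w
    by_cases hw : ‖w‖ ∈ T
    · have : ‖w‖ ^ 2 ∈ Metric.closedBall (R ^ 2) (3 * R * ε) := by
        rw [Metric.mem_closedBall, Real.dist_eq, abs_le]
        obtain ⟨h1, h2⟩ := hw
        have := norm_nonneg w
        constructor <;> nlinarith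
      rw [Set.indicator_of_mem hw, Set.indicator_of_mem this]
    · rw [Set.indicator_of_notMem hw]
      exact zero_le
  calc ∫⁻ w in S, ‖h (‖w‖ ^ 2) * (1 / (z - w) ^ 2)‖ₑ
      = ∫⁻ w, φ (u * w) := by rw [← lintegral_indicator hSm, ← hrot]
    _ = ∫⁻ r in Set.Ioi 0, ENNReal.ofReal r *
          ∫⁻ θ in Set.Ioo (-Real.pi) Real.pi, φ (u * circleMap 0 r θ) :=
        lintegral_polar (hφm.comp (by fun_prop))
    _ ≤ ∫⁻ r in Set.Ioi 0, ENNReal.ofReal r * (T.indicator (fun r => ‖h (r ^ 2)‖ₑ) r *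
          ENNReal.ofReal (2 * Real.pi / (ε * (R / 3)))) := by
        refine lintegral_mono_ae ?_
        rw [ae_restrict_iff' measurableSet_Ioi]
        filter_upwards with r hr
        gcongr
        exact hbound r hr
    _ = ENNReal.ofReal (3 / (ε * R)) * ∫⁻ w : ℂ, T.indicator (fun r => ‖h (r ^ 2)‖ₑ) ‖w‖ := by
        rw [hpolar, ← lintegral_const_mul' _ _ ENNReal.ofReal_ne_top]
        refine lintegral_congr fun r => ?_
        have e : 2 * Real.pi / (ε * (R / 3)) = 3 / (ε * R) * (2 * Real.pi) := by field_simp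
        rw [e, ENNReal.ofReal_mul (by positivity)]
        ring
    _ ≤ ENNReal.ofReal (3 / (ε * R)) * ∫⁻ w : ℂ,
          (Metric.closedBall (R ^ 2) (3 * R * ε)).indicator (fun s => ‖h s‖ₑ) (‖w‖ ^ 2) := by
        gcongr with w
        exact hsub w
    _ ≤ _ := by
        rw [lintegral_comp_norm_sq
          (Measurable.indicator (by fun_prop) Metric.isClosed_closedBall.measurableSet), ← mul_assoc]
        have e : ENNReal.ofReal (3 / (ε * R)) * NNReal.pi =
            ENNReal.ofReal (3 * Real.pi / (ε * R)) := by
          rw [show (NNReal.pi : ENNReal) = ENNReal.ofReal Real.pi by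
            rw [← NNReal.coe_real_pi, ENNReal.ofReal_coe_nnreal],
            ← ENNReal.ofReal_mul (by positivity)]
          congr 1; ring
        rw [e]
        refine mul_le_mul' le_rfl ?_
        refine (setLIntegral_le_lintegral _ _).trans ?_
        rw [lintegral_indicator Metric.isClosed_closedBall.measurableSet]

/-! ### The truncated integral of a disc -/

/-- The truncated kernel integrates to zero over a disc: in polar coordinates around `z`, the
distances from `z` to the boundary circle in two opposite directions multiply to the power of the
point `z`, so the logarithms of these distances have no second Fourier coefficient. -/
lemma integral_disc_kernel_eq_zero {z : ℂ} {ρ ε : ℝ} (hε : 0 < ε) (h : ε ≤ ρ - ‖z‖) :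
    ∫ w in {w : ℂ | ‖w‖ < ρ ∧ ε < ‖z - w‖}, 1 / (z - w) ^ 2 = 0 := by
  have hρ : ‖z‖ < ρ := by linarith
  have hz0 := norm_nonneg z
  set S : Set ℂ := {u : ℂ | ‖z - u‖ < ρ ∧ ε < ‖u‖} with hS
  have hSm : MeasurableSet S :=
    (measurableSet_lt (by fun_prop : Measurable fun u : ℂ => ‖z - u‖) measurable_const).inter
      (measurableSet_lt measurable_const measurable_norm)
  have hTm : MeasurableSet {w : ℂ | ‖w‖ < ρ ∧ ε < ‖z - w‖} :=
    (measurableSet_lt measurable_norm measurable_const).inter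
      (measurableSet_lt measurable_const (by fun_prop : Measurable fun u : ℂ => ‖z - u‖))
  set φ : ℂ → ℂ := S.indicator fun u => 1 / u ^ 2 with hφ
  have hφm : Measurable φ := Measurable.indicator (by fun_prop) hSm
  have hφi : Integrable φ := by
    rw [hφ, integrable_indicator_iff hSm]
    refine Measure.integrableOn_of_bounded (M := 1 / ε ^ 2) ?_
      (by fun_prop : Measurable fun u : ℂ => 1 / u ^ 2).aestronglyMeasurable ?_
    · refine ((measure_mono fun u hu => ?_).trans_lt
        (measure_ball_lt_top (x := z) (r := ρ) (μ := volume))).ne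
      rw [Metric.mem_ball, dist_comm, dist_eq_norm]
      exact hu.1
    · rw [ae_restrict_iff' hSm]
      filter_upwards with u hu
      rw [norm_div, norm_one, norm_pow]
      exact one_div_le_one_div_of_le (by positivity) (pow_le_pow_left₀ hε.le hu.2.le 2)
  have hshift : ∫ w in {w : ℂ | ‖w‖ < ρ ∧ ε < ‖z - w‖}, 1 / (z - w) ^ 2 = ∫ u, φ u := by
    rw [← integral_sub_left_eq_self φ volume z, ← integral_indicator hTm]
    congr 1
    ext w
    have : z - w ∈ S ↔ w ∈ {w : ℂ | ‖w‖ < ρ ∧ ε < ‖z - w‖} := by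
      simp only [hS, Set.mem_ofPred_eq, sub_sub_cancel]
    by_cases hw : w ∈ {w : ℂ | ‖w‖ < ρ ∧ ε < ‖z - w‖}
    · rw [Set.indicator_of_mem hw, hφ, Set.indicator_of_mem (this.2 hw)]
    · rw [Set.indicator_of_notMem hw, hφ, Set.indicator_of_notMem (fun h => hw (this.1 h))]
  rw [hshift, integral_polar_symm hφm hφi]
  -- `D θ` is the distance from `z` to the circle of radius `ρ` in the direction `-e^{iθ}`
  set t : ℝ → ℝ := fun θ => z.re * Real.cos θ + z.im * Real.sin θ with ht
  set D : ℝ → ℝ := fun θ => t θ + √(ρ ^ 2 - ‖z‖ ^ 2 + t θ ^ 2) with hD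
  set e : ℝ → ℂ := fun θ => 1 / (0 - circleMap 0 1 θ) ^ 2 with he
  have hpow : 0 < ρ ^ 2 - ‖z‖ ^ 2 := by nlinarith
  have hsqrt : ∀ θ, √(ρ ^ 2 - ‖z‖ ^ 2 + t θ ^ 2) ^ 2 = ρ ^ 2 - ‖z‖ ^ 2 + t θ ^ 2 := fun θ =>
    Real.sq_sqrt (by positivity)
  have hsqrt0 : ∀ θ, 0 ≤ √(ρ ^ 2 - ‖z‖ ^ 2 + t θ ^ 2) := fun θ => Real.sqrt_nonneg _
  have hnormsq : ‖z‖ ^ 2 = z.re ^ 2 + z.im ^ 2 := by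
    rw [← Complex.normSq_eq_norm_sq, Complex.normSq_apply]; ring
  have htle : ∀ θ, |t θ| ≤ ‖z‖ := fun θ => by
    apply abs_le_of_sq_le_sq _ hz0
    rw [hnormsq]
    have := Real.sin_sq_add_cos_sq θ
    nlinarith [sq_nonneg (z.re * Real.sin θ - z.im * Real.cos θ)]
  have hDε : ∀ θ, ε ≤ D θ := fun θ => by
    have h1 : ρ - ‖z‖ - t θ ≤ √(ρ ^ 2 - ‖z‖ ^ 2 + t θ ^ 2) := by
      apply Real.le_sqrt_of_sq_le
      have h2 : 0 ≤ ‖z‖ + t θ := by linarith [(abs_le.1 (htle θ)).1]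
      nlinarith [mul_nonneg h2 (by linarith : 0 ≤ ρ - ‖z‖)]
    simp only [hD]
    linarith
  have hmem : ∀ θ r, 0 < r → (circleMap 0 r θ ∈ S ↔ r ∈ Set.Ioo ε (D θ)) := by
    intro θ r hr
    have hn : ‖z - circleMap 0 r θ‖ ^ 2 = (r - t θ) ^ 2 + ‖z‖ ^ 2 - t θ ^ 2 := by
      rw [hnormsq, ← Complex.normSq_eq_norm_sq, Complex.normSq_apply, circleMap_zero]
      simp only [Complex.sub_re, Complex.sub_im,
        Complex.re_ofReal_mul, Complex.im_ofReal_mul, Complex.exp_ofReal_mul_I_re,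
        Complex.exp_ofReal_mul_I_im, ht]
      have := Real.sin_sq_add_cos_sq θ
      linear_combination r ^ 2 * this
    have h1 : ‖z - circleMap 0 r θ‖ < ρ ↔ r < D θ := by
      rw [← pow_lt_pow_iff_left₀ (norm_nonneg _) (by linarith) two_ne_zero, hn]
      have hs := hsqrt θ
      have hs0 := hsqrt0 θ
      have hst : |t θ| < √(ρ ^ 2 - ‖z‖ ^ 2 + t θ ^ 2) := by
        apply abs_lt_of_sq_lt_sq _ hs0
        linarith
      have hst1 := (abs_lt.1 hst).2
      constructor
      · intro hlt
        have : r - t θ < √(ρ ^ 2 - ‖z‖ ^ 2 + t θ ^ 2) := by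
          apply lt_of_pow_lt_pow_left₀ 2 hs0
          linarith
        simp only [hD]; linarith
      · intro hlt
        simp only [hD] at hlt
        have : (r - t θ) ^ 2 < √(ρ ^ 2 - ‖z‖ ^ 2 + t θ ^ 2) ^ 2 := by
          apply sq_lt_sq'
          · linarith
          · linarith
        linarith
    have h2 : ‖circleMap 0 r θ‖ = r := by rw [norm_circleMap_zero, abs_of_pos hr]
    simp only [hS, Set.mem_ofPred_eq, Set.mem_Ioo, h1, h2]
    tauto
  have hinner : ∀ θ, ∫ r in Set.Ioi (0 : ℝ), r • φ (circleMap 0 r θ) =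
      Real.log (D θ / ε) • e θ := by
    intro θ
    have h1 : ∫ r in Set.Ioi (0 : ℝ), r • φ (circleMap 0 r θ) =
        ∫ r in Set.Ioi (0 : ℝ), (Set.Ioo ε (D θ)).indicator (fun r => (r⁻¹ : ℝ) • e θ) r := by
      refine setIntegral_congr_fun measurableSet_Ioi fun r hr => ?_
      have hr0 : 0 < r := hr
      by_cases hrm : r ∈ Set.Ioo ε (D θ)
      · simp only [hφ]
        rw [Set.indicator_of_mem hrm, Set.indicator_of_mem ((hmem θ r hr0).2 hrm)]
        have hrC : (r : ℂ) ≠ 0 := by exact_mod_cast hr0.ne'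
        simp only [he, circleMap_zero, zero_sub, neg_sq, Complex.real_smul]
        have := Complex.exp_ne_zero (θ * Complex.I)
        push_cast
        field_simp
      · simp only [hφ]
        rw [Set.indicator_of_notMem hrm,
          Set.indicator_of_notMem (fun h => hrm ((hmem θ r hr0).1 h)), smul_zero]
    rw [h1, setIntegral_indicator measurableSet_Ioo,
      Set.inter_eq_right.2 (Set.Ioo_subset_Ioi_self.trans (Set.Ioi_subset_Ioi hε.le)),
      integral_smul_const,
      ← integral_Ioc_eq_integral_Ioo, ← intervalIntegral.integral_of_le (hDε θ),
      integral_inv_of_pos hε (hε.trans_le (hDε θ))]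
  simp only [hinner]
  set g : ℝ → ℂ := fun θ => Real.log (D θ / ε) • e θ with hg
  have hecont : Continuous e := by
    have : ∀ θ, (0 - circleMap 0 1 θ) ^ 2 ≠ 0 := fun θ => by
      simp [circleMap_zero, Complex.exp_ne_zero]
    simp only [he]
    fun_prop (disch := assumption)
  have hgcont : Continuous g := by
    have h1 : Continuous fun θ => D θ / ε := by simp only [hD, ht]; fun_prop
    have h2 : Continuous fun θ => Real.log (D θ / ε) :=
      h1.log fun θ => (div_pos (hε.trans_le (hDε θ)) hε).ne'
    exact h2.smul hecont
  have ht2 : ∀ θ, t (θ + Real.pi) = -t θ := fun θ => by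
    simp only [ht, Real.cos_add_pi, Real.sin_add_pi]; ring
  have he2 : ∀ θ, e (θ + Real.pi) = e θ := fun θ => by
    simp only [he, circleMap_zero]
    push_cast
    rw [add_mul, Complex.exp_add, Complex.exp_pi_mul_I]
    ring
  have hg2 : ∀ θ, g θ + g (θ + Real.pi) =
      (Real.log ((ρ ^ 2 - ‖z‖ ^ 2) / ε ^ 2) : ℂ) * e θ := fun θ => by
    simp only [hg, he2]
    rw [← add_smul, ← Real.log_mul (div_pos (hε.trans_le (hDε _)) hε).ne'
      (div_pos (hε.trans_le (hDε _)) hε).ne', Complex.real_smul]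
    congr 3
    have hs := hsqrt θ
    simp only [hD, ht2, neg_sq]
    field_simp
    linarith
  have hgper : Function.Periodic g (2 * Real.pi) := fun θ => by
    have h1 : t (θ + 2 * Real.pi) = t θ := by
      rw [show θ + 2 * Real.pi = θ + Real.pi + Real.pi by ring, ht2, ht2, neg_neg]
    have h2 : e (θ + 2 * Real.pi) = e θ := by
      rw [show θ + 2 * Real.pi = θ + Real.pi + Real.pi by ring, he2, he2]
    simp only [hg, hD, h1, h2]
  have he0 : ∫ θ in -Real.pi..Real.pi, e θ = 0 := by
    rw [intervalIntegral.integral_of_le (by linarith [Real.pi_pos]), integral_Ioc_eq_integral_Ioo,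
      setIntegral_circleMap (fun w => 1 / (0 - w) ^ 2), circleAverage_kernel_of_gt (by simp),
      mul_zero]
  rw [← integral_Ioc_eq_integral_Ioo,
    ← intervalIntegral.integral_of_le (by linarith [Real.pi_pos])]
  have hshift2 : ∫ θ in -Real.pi..Real.pi, g (θ + Real.pi) = ∫ θ in -Real.pi..Real.pi, g θ := by
    rw [intervalIntegral.integral_comp_add_right]
    have := hgper.intervalIntegral_add_eq (-Real.pi + Real.pi) (-Real.pi)
    rwa [show -Real.pi + Real.pi + 2 * Real.pi = Real.pi + Real.pi by ring,
      show -Real.pi + 2 * Real.pi = Real.pi by ring] at this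
  have hsum : ∫ θ in -Real.pi..Real.pi, (g θ + g (θ + Real.pi)) = 0 := by
    simp only [hg2]
    rw [intervalIntegral.integral_const_mul, he0, mul_zero]
  rw [intervalIntegral.integral_add (hgcont.intervalIntegrable _ _)
    (Continuous.intervalIntegrable (by fun_prop) _ _), hshift2, ← two_mul] at hsum
  exact (mul_eq_zero.1 hsum).resolve_left two_ne_zero

/-! ### The principal value at Lebesgue points -/

/-- By Young's inequality, as `‖z - w‖ ^ (-2 q)` is integrable at infinity for the conjugate exponent
`q > 1`. -/
lemma integrableOn_mul_kernel {F : ℂ → ℂ} {p : ℝ} (hp : 1 < p) (hF : MemLp F (ENNReal.ofReal p))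
    (z : ℂ) {ε : ℝ} (hε : 0 < ε) :
    IntegrableOn (fun w => F w * (1 / (z - w) ^ 2)) {w : ℂ | ε < ‖z - w‖} := by
  have hp0 : 0 < p := by linarith
  have hpq := Real.HolderConjugate.conjExponent hp
  set q := p.conjExponent
  have hq1 : 1 < q := hpq.symm.lt
  have hFp : Integrable fun w => ‖F w‖ ^ p := by
    have h1 := hF.integrable_norm_rpow (by simpa using hp0) ENNReal.ofReal_ne_top
    rwa [ENNReal.toReal_ofReal hp0.le] at h1
  have hk : Integrable fun w : ℂ => (1 + ‖z - w‖) ^ (-(2 * q)) :=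
    (integrable_one_add_norm (E := ℂ) (μ := volume) (r := 2 * q)
      (by rw [Complex.finrank_real_complex]; push_cast; linarith)).comp_sub_left z
  have hSm : MeasurableSet {w : ℂ | ε < ‖z - w‖} :=
    measurableSet_lt measurable_const (by fun_prop : Measurable fun u : ℂ => ‖z - u‖)
  set C : ℝ := ((1 + ε) / ε) ^ (2 * q) with hC
  refine Integrable.mono' (g := fun w => ‖F w‖ ^ p / p + C * (1 + ‖z - w‖) ^ (-(2 * q)) / q)
    (((hFp.div_const p).add ((hk.const_mul C).div_const q)).integrableOn)
    (hF.1.restrict.mul (by fun_prop : Measurable fun w : ℂ => 1 / (z - w) ^ 2).aestronglyMeasurable)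
    ?_
  rw [ae_restrict_iff' hSm]
  filter_upwards with w hw
  have hw' : ε < ‖z - w‖ := hw
  have hw0 : 0 < ‖z - w‖ := hε.trans hw'
  rw [norm_mul, norm_div, norm_one, norm_pow]
  refine (Real.young_inequality_of_nonneg (norm_nonneg _) (by positivity) hpq).trans ?_
  gcongr
  have e1 : (1 / ‖z - w‖ ^ 2) ^ q = ‖z - w‖ ^ (-(2 * q)) := by
    rw [one_div, Real.inv_rpow (by positivity), Real.rpow_neg hw0.le, ← Real.rpow_natCast,
      ← Real.rpow_mul hw0.le]
    norm_num
  rw [e1, hC, Real.rpow_neg hw0.le, Real.rpow_neg (by positivity), ← Real.inv_rpow hw0.le,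
    ← Real.inv_rpow (by positivity), ← Real.mul_rpow (by positivity) (by positivity)]
  apply Real.rpow_le_rpow (by positivity) _ (by linarith)
  rw [← div_eq_mul_inv, ← one_div, div_div, div_le_div_iff₀ hw0 (by positivity)]
  nlinarith

/-- The principal value of a radial function at a point whose squared modulus is a Lebesgue point of
the profile. -/
theorem tendsto_beurlingTrunc {f : ℝ → ℂ} (hf : Measurable f) (hloc : LocallyIntegrable f) {p : ℝ}
    (hp : 1 < p) (hFp : MemLp (fun z : ℂ => f (‖z‖ ^ 2)) (ENNReal.ofReal p)) {z : ℂ} (hz : z ≠ 0)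
    (hleb : Tendsto (fun δ => δ⁻¹ * ∫ s in Metric.closedBall (‖z‖ ^ 2) δ, ‖f s - f (‖z‖ ^ 2)‖)
      (𝓝[>] 0) (𝓝 0)) :
    Tendsto (fun ε => beurlingTrunc (fun w => f (‖w‖ ^ 2)) ε z) (𝓝[>] (0 : ℝ))
      (𝓝 ((‖z‖ : ℂ) ^ 2 / z ^ 2 * (f (‖z‖ ^ 2) - hardy f (‖z‖ ^ 2)))) := by
  set R := ‖z‖ with hR
  have hR0 : 0 < R := norm_pos_iff.2 hz
  set c := f (R ^ 2) with hc
  set d : ℝ → ℂ := (Set.Iio ((2 * R) ^ 2)).indicator fun _ => c with hd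
  have hdm : Measurable d := measurable_const.indicator measurableSet_Iio
  set h : ℝ → ℂ := fun s => f s - d s with hh
  have hhm : Measurable h := hf.sub hdm
  have hdN : (fun w : ℂ => d (‖w‖ ^ 2)) = {w : ℂ | ‖w‖ < 2 * R}.indicator fun _ => c := by
    ext w
    have : ‖w‖ ^ 2 < (2 * R) ^ 2 ↔ ‖w‖ < 2 * R :=
      pow_lt_pow_iff_left₀ (norm_nonneg _) (by positivity) two_ne_zero
    by_cases hw : ‖w‖ < 2 * R
    · rw [Set.indicator_of_mem (show w ∈ {w : ℂ | ‖w‖ < 2 * R} from hw), hd,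
        Set.indicator_of_mem (show ‖w‖ ^ 2 ∈ Set.Iio ((2 * R) ^ 2) from this.2 hw)]
    · rw [Set.indicator_of_notMem (show w ∉ {w : ℂ | ‖w‖ < 2 * R} from hw), hd,
        Set.indicator_of_notMem (show ‖w‖ ^ 2 ∉ Set.Iio ((2 * R) ^ 2) from fun h => hw (this.1 h))]
  have hBm : MeasurableSet {w : ℂ | ‖w‖ < 2 * R} := measurableSet_lt measurable_norm measurable_const
  have hBfin : volume {w : ℂ | ‖w‖ < 2 * R} ≠ ⊤ := by
    refine ((measure_mono fun u hu => ?_).trans_lt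
      (measure_ball_lt_top (x := (0 : ℂ)) (r := 2 * R) (μ := volume))).ne
    rw [mem_ball_zero_iff]
    exact hu
  have hdLp : MemLp (fun w : ℂ => d (‖w‖ ^ 2)) (ENNReal.ofReal p) := by
    rw [hdN]
    exact memLp_indicator_const _ hBm _ (Or.inr hBfin)
  have hhLp : MemLp (fun w : ℂ => h (‖w‖ ^ 2)) (ENNReal.ofReal p) := hFp.sub hdLp
  have hint : ∀ a b : ℝ, IntervalIntegrable f volume a b := fun a b =>
    (hloc.integrableOn_isCompact isCompact_uIcc).intervalIntegrable
  -- the annular part of the truncated integral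
  set Ann : ℝ → Set ℂ := fun ε => {w : ℂ | R - ε ≤ ‖w‖ ∧ ‖w‖ ≤ R + ε ∧ ε < ‖z - w‖} with hAnn
  set err : ℝ → ℂ := fun ε => ∫ w in Ann ε, h (‖w‖ ^ 2) * (1 / (z - w) ^ 2) with herr
  have hmain : ∀ ε, 0 < ε → ε ≤ R / 2 → beurlingTrunc (fun w => f (‖w‖ ^ 2)) ε z =
      -(1 / (Real.pi : ℂ)) * (Real.pi / z ^ 2 *
        ((∫ s in (0 : ℝ)..(R - ε) ^ 2, f s) - (R - ε) ^ 2 * c) + err ε) := by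
    intro ε hε hεR
    set E : Set ℂ := {w : ℂ | ε < ‖z - w‖} with hE
    have hEm : MeasurableSet E :=
      measurableSet_lt measurable_const (by fun_prop : Measurable fun u : ℂ => ‖z - u‖)
    have hih := integrableOn_mul_kernel hp hhLp z hε
    have hid := integrableOn_mul_kernel hp hdLp z hε
    have hd0 : ∫ w in E, d (‖w‖ ^ 2) * (1 / (z - w) ^ 2) = 0 := by
      have e1 : ∀ w : ℂ, d (‖w‖ ^ 2) * (1 / (z - w) ^ 2) =
          {w : ℂ | ‖w‖ < 2 * R}.indicator (fun w => c * (1 / (z - w) ^ 2)) w := fun w => by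
        rw [show d (‖w‖ ^ 2) = {w : ℂ | ‖w‖ < 2 * R}.indicator (fun _ => c) w from congrFun hdN w]
        by_cases hw : w ∈ {w : ℂ | ‖w‖ < 2 * R}
        · rw [Set.indicator_of_mem hw, Set.indicator_of_mem hw]
        · rw [Set.indicator_of_notMem hw, Set.indicator_of_notMem hw, zero_mul]
      simp only [e1]
      rw [setIntegral_indicator hBm, integral_const_mul]
      have e2 : E ∩ {w : ℂ | ‖w‖ < 2 * R} = {w : ℂ | ‖w‖ < 2 * R ∧ ε < ‖z - w‖} := by
        ext w; exact and_comm
      rw [e2, integral_disc_kernel_eq_zero hε (by linarith), mul_zero]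
    have hI : MeasurableSet {w : ℂ | ‖w‖ < R - ε} := measurableSet_lt measurable_norm measurable_const
    have hO : MeasurableSet {w : ℂ | R + ε < ‖w‖} := measurableSet_lt measurable_const measurable_norm
    have hA : MeasurableSet (Ann ε) :=
      (measurableSet_le measurable_const measurable_norm).inter
        ((measurableSet_le measurable_norm measurable_const).inter hEm)
    have hIE : {w : ℂ | ‖w‖ < R - ε} ⊆ E := fun w hw => by
      have h1 : ‖w‖ < R - ε := hw
      have := norm_sub_norm_le z w
      change ε < ‖z - w‖
      linarith
    have hOE : {w : ℂ | R + ε < ‖w‖} ⊆ E := fun w hw => by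
      have h1 : R + ε < ‖w‖ := hw
      have := norm_sub_norm_le w z
      rw [norm_sub_rev] at this
      change ε < ‖z - w‖
      linarith
    have hAE : Ann ε ⊆ E := fun w hw => hw.2.2
    have hEeq : E = ({w : ℂ | ‖w‖ < R - ε} ∪ {w : ℂ | R + ε < ‖w‖}) ∪ Ann ε := by
      apply Set.Subset.antisymm
      · intro w hw
        by_cases h1 : ‖w‖ < R - ε
        · exact Or.inl (Or.inl h1)
        by_cases h2 : R + ε < ‖w‖
        · exact Or.inl (Or.inr h2)
        exact Or.inr ⟨not_lt.1 h1, not_lt.1 h2, hw⟩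
      · exact Set.union_subset (Set.union_subset hIE hOE) hAE
    have hdisj1 : Disjoint {w : ℂ | ‖w‖ < R - ε} {w : ℂ | R + ε < ‖w‖} := by
      rw [Set.disjoint_left]
      intro w h1 h2
      have h1' : ‖w‖ < R - ε := h1
      have h2' : R + ε < ‖w‖ := h2
      linarith
    have hdisj2 : Disjoint ({w : ℂ | ‖w‖ < R - ε} ∪ {w : ℂ | R + ε < ‖w‖}) (Ann ε) := by
      rw [Set.disjoint_left]
      rintro w (h1 | h1) ⟨h2, h3, _⟩
      · exact absurd h1 (not_lt.2 h2)
      · exact absurd h1 (not_lt.2 h3)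
    have hIint : IntegrableOn (fun w : ℂ => h (‖w‖ ^ 2)) {w | ‖w‖ < R - ε} := by
      have hfin : volume {w : ℂ | ‖w‖ < R - ε} ≠ ⊤ :=
        ((measure_mono fun w hw => (lt_of_lt_of_le hw (by linarith) : ‖w‖ < 2 * R)).trans_lt
          hBfin.lt_top).ne
      have : IsFiniteMeasure (volume.restrict {w : ℂ | ‖w‖ < R - ε}) :=
        ⟨by rw [Measure.restrict_apply_univ]; exact hfin.lt_top⟩
      exact (hhLp.restrict _).integrable (by rw [ENNReal.one_le_ofReal]; exact hp.le)
    have hhint : ∫ s in (0 : ℝ)..(R - ε) ^ 2, h s =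
        (∫ s in (0 : ℝ)..(R - ε) ^ 2, f s) - (R - ε) ^ 2 * c := by
      have e1 : ∫ s in (0 : ℝ)..(R - ε) ^ 2, h s = ∫ s in (0 : ℝ)..(R - ε) ^ 2, (f s - c) := by
        refine intervalIntegral.integral_congr fun s hs => ?_
        rw [Set.uIcc_of_le (sq_nonneg _)] at hs
        have : s ∈ Set.Iio ((2 * R) ^ 2) := by
          refine lt_of_le_of_lt hs.2 ?_
          apply pow_lt_pow_left₀ (by linarith) (by linarith) two_ne_zero
        simp only [hh, hd, Set.indicator_of_mem this]
      rw [e1, intervalIntegral.integral_sub (hint _ _) intervalIntegrable_const,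
        intervalIntegral.integral_const, sub_zero, Complex.real_smul]
      push_cast
      ring
    have hsplit : ∫ w in E, h (‖w‖ ^ 2) * (1 / (z - w) ^ 2) = Real.pi / z ^ 2 *
        ((∫ s in (0 : ℝ)..(R - ε) ^ 2, f s) - (R - ε) ^ 2 * c) + err ε := by
      rw [← hhint, hEeq, setIntegral_union hdisj2 hA (hih.mono_set (Set.union_subset hIE hOE))
        (hih.mono_set hAE), setIntegral_union hdisj1 hO (hih.mono_set hIE) (hih.mono_set hOE),
        integral_inside hhm (by linarith) (by linarith) hIint (hih.mono_set hIE),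
        integral_outside hhm (by linarith) (hih.mono_set hOE), add_zero]
    rw [beurlingTrunc, ← hsplit]
    congr 1
    have e : ∀ w : ℂ, f (‖w‖ ^ 2) / (z - w) ^ 2 =
        h (‖w‖ ^ 2) * (1 / (z - w) ^ 2) + d (‖w‖ ^ 2) * (1 / (z - w) ^ 2) := fun w => by
      simp only [hh]; ring
    simp only [e]
    rw [integral_add hih hid, hd0, add_zero]
  have herr0 : Tendsto err (𝓝[>] 0) (𝓝 0) := by
    have hδ : Tendsto (fun ε : ℝ => 3 * R * ε) (𝓝[>] 0) (𝓝[>] 0) := by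
      rw [tendsto_nhdsWithin_iff]
      refine ⟨?_, ?_⟩
      · have : Tendsto (fun ε : ℝ => 3 * R * ε) (𝓝 0) (𝓝 (3 * R * 0)) :=
          (continuous_const.mul continuous_id).tendsto 0
        rw [mul_zero] at this
        exact this.mono_left nhdsWithin_le_nhds
      · filter_upwards [self_mem_nhdsWithin] with ε hε
        have : 0 < ε := hε
        exact Set.mem_Ioi.2 (by positivity)
    have h1 := (hleb.comp hδ).const_mul (9 * Real.pi)
    rw [mul_zero] at h1
    refine squeeze_zero_norm' ?_ h1
    filter_upwards [Ioc_mem_nhdsGT (show (0 : ℝ) < R / 2 by positivity)] with ε hε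
    have hε0 : 0 < ε := hε.1
    set B := Metric.closedBall (R ^ 2) (3 * R * ε) with hB
    have hfB : IntegrableOn (fun s => f s - c) B :=
      (hloc.integrableOn_isCompact (isCompact_closedBall _ _)).sub
        (integrableOn_const (hs := (measure_closedBall_lt_top).ne))
    have h2 := (enorm_integral_le_lintegral_enorm _).trans (lintegral_annulus_le hhm hε0 hε.2)
    have h3 : ∫⁻ s in B, ‖h s‖ₑ = ENNReal.ofReal (∫ s in B, ‖f s - c‖) := by
      rw [ofReal_integral_norm_eq_lintegral_enorm hfB]
      refine setLIntegral_congr_fun Metric.isClosed_closedBall.measurableSet fun s hs => ?_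
      have : s ∈ Set.Iio ((2 * R) ^ 2) := by
        rw [hB, Metric.mem_closedBall, Real.dist_eq, abs_le] at hs
        rw [Set.mem_Iio]
        nlinarith [hε.2, hs.2, mul_le_mul_of_nonneg_left hε.2 hR0.le]
      simp only [hh, hd, Set.indicator_of_mem this]
    rw [h3, ← ENNReal.ofReal_mul (by positivity), ← ofReal_norm,
      ENNReal.ofReal_le_ofReal_iff (mul_nonneg (by positivity)
        (integral_nonneg fun _ => norm_nonneg _))] at h2
    refine h2.trans (le_of_eq ?_)
    simp only [Function.comp_apply]
    rw [← mul_assoc]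
    congr 1
    field_simp
    ring
  have hG : Tendsto (fun ε : ℝ => ∫ s in (0 : ℝ)..(R - ε) ^ 2, f s) (𝓝[>] 0)
      (𝓝 (∫ s in (0 : ℝ)..R ^ 2, f s)) := by
    have h1 : Continuous fun x => ∫ s in (0 : ℝ)..x, f s :=
      intervalIntegral.continuous_primitive hint 0
    have h2 : Continuous fun ε : ℝ => ∫ s in (0 : ℝ)..(R - ε) ^ 2, f s := by fun_prop
    have h3 := h2.tendsto 0
    rw [sub_zero] at h3
    exact h3.mono_left nhdsWithin_le_nhds
  have hq : Tendsto (fun ε : ℝ => ((R : ℂ) - ε) ^ 2 * c) (𝓝[>] 0) (𝓝 ((R : ℂ) ^ 2 * c)) := by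
    have h2 : Continuous fun ε : ℝ => ((R : ℂ) - ε) ^ 2 * c := by fun_prop
    have h3 := h2.tendsto 0
    rw [Complex.ofReal_zero, sub_zero] at h3
    exact h3.mono_left nhdsWithin_le_nhds
  have hlim := (((hG.sub hq).const_mul (Real.pi / z ^ 2 : ℂ)).add herr0).const_mul
    (-(1 / (Real.pi : ℂ)))
  have hval : -(1 / (Real.pi : ℂ)) * (Real.pi / z ^ 2 *
      ((∫ s in (0 : ℝ)..R ^ 2, f s) - (R : ℂ) ^ 2 * c) + 0) =
      (R : ℂ) ^ 2 / z ^ 2 * (c - hardy f (R ^ 2)) := by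
    have hpi : (Real.pi : ℂ) ≠ 0 := by exact_mod_cast Real.pi_ne_zero
    have hRC : (R : ℂ) ≠ 0 := by exact_mod_cast hR0.ne'
    rw [hardy]
    push_cast
    field_simp
    ring
  rw [hval] at hlim
  refine hlim.congr' ?_
  filter_upwards [Ioc_mem_nhdsGT (show (0 : ℝ) < R / 2 by positivity)] with ε hε
  rw [hmain ε hε.1 hε.2]

/-! ### The Beurling–Ahlfors transform of a radial function -/

lemma ae_tendsto_closedBall_norm_sub {f : ℝ → ℂ} (hloc : LocallyIntegrable f) :
    ∀ᵐ s : ℝ, Tendsto (fun δ => δ⁻¹ * ∫ y in Metric.closedBall s δ, ‖f y - f s‖)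
      (𝓝[>] 0) (𝓝 0) := by
  filter_upwards [IsUnifLocDoublingMeasure.ae_tendsto_average_norm_sub volume hloc 1] with s hs
  have h1 := hs (l := 𝓝[>] (0 : ℝ)) (fun _ => s) (fun δ => δ) tendsto_id (by
    filter_upwards [self_mem_nhdsWithin] with δ hδ
    have : 0 < δ := hδ
    exact Metric.mem_closedBall_self (by linarith))
  have h2 := h1.const_mul 2
  rw [mul_zero] at h2
  refine h2.congr' ?_
  filter_upwards [self_mem_nhdsWithin] with δ hδ
  have hδ0 : 0 < δ := hδ
  rw [setAverage_eq, measureReal_def, Real.volume_closedBall, ENNReal.toReal_ofReal (by linarith),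
    smul_eq_mul, mul_inv]
  ring

lemma hardy_indicator {f : ℝ → ℂ} {s : ℝ} (hs : 0 < s) :
    hardy ((Set.Ioi 0).indicator f) s = hardy f s := by
  rw [hardy, hardy]
  congr 1
  rw [intervalIntegral.integral_of_le hs.le, intervalIntegral.integral_of_le hs.le]
  exact setIntegral_congr_fun measurableSet_Ioc fun x hx => Set.indicator_of_mem hx.1 f

lemma memLp_profile {F : ℂ → ℂ} {f : ℝ → ℂ} {q : ENNReal} (hf : Measurable f) (hF : MemLp F q)
    (hFf : F =ᵐ[volume] fun z => f (‖z‖ ^ 2)) : MemLp f q (volume.restrict (Set.Ioi 0)) := by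
  refine ⟨hf.aestronglyMeasurable, ?_⟩
  have h1 := hF.2
  rw [eLpNorm_congr_ae hFf, eLpNorm_comp_norm_sq hf.aestronglyMeasurable] at h1
  by_contra hcon
  rw [not_lt, top_le_iff] at hcon
  rw [hcon, ENNReal.smul_top] at h1
  simp [NNReal.pi_ne_zero] at h1

/-- For a radial function with profile `f` the principal value exists almost everywhere and equals
`(|z|^2 / z^2) (f - Hf)(|z|^2)`. -/
theorem ae_beurling_eq {F : ℂ → ℂ} {f : ℝ → ℂ} {p : ℝ} (hp : 1 < p) (hf : Measurable f)
    (hF : MemLp F (ENNReal.ofReal p)) (hFf : F =ᵐ[volume] fun z => f (‖z‖ ^ 2)) :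
    ∀ᵐ z : ℂ, BeurlingExistsAt F z ∧
      beurling F z = (‖z‖ : ℂ) ^ 2 / z ^ 2 * (f (‖z‖ ^ 2) - hardy f (‖z‖ ^ 2)) := by
  have h1p : 1 ≤ ENNReal.ofReal p := by rw [ENNReal.one_le_ofReal]; exact hp.le
  set f₀ := (Set.Ioi 0).indicator f with hf₀
  have hf₀m : Measurable f₀ := hf.indicator measurableSet_Ioi
  have hf₀Lp : MemLp f₀ (ENNReal.ofReal p) :=
    (memLp_indicator_iff_restrict measurableSet_Ioi).2 (memLp_profile hf hF hFf)
  have hloc : LocallyIntegrable f₀ := hf₀Lp.locallyIntegrable h1p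
  have hne : ∀ᵐ z : ℂ, z ≠ 0 := by simp [ae_iff]
  have hFf₀ : F =ᵐ[volume] fun z => f₀ (‖z‖ ^ 2) := by
    filter_upwards [hFf, hne] with z hz hz0
    have : ‖z‖ ^ 2 ∈ Set.Ioi (0 : ℝ) := by
      have := norm_pos_iff.2 hz0
      exact Set.mem_Ioi.2 (by positivity)
    rw [hz, hf₀, Set.indicator_of_mem this]
  have hFLp : MemLp (fun z : ℂ => f₀ (‖z‖ ^ 2)) (ENNReal.ofReal p) := (memLp_congr_ae hFf₀).1 hF
  have htrunc : ∀ z ε, beurlingTrunc F ε z = beurlingTrunc (fun w => f₀ (‖w‖ ^ 2)) ε z := by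
    intro z ε
    rw [beurlingTrunc, beurlingTrunc]
    congr 1
    refine integral_congr_ae (ae_restrict_of_ae ?_)
    filter_upwards [hFf₀] with w hw
    rw [hw]
  filter_upwards [ae_norm_sq (ae_restrict_of_ae (ae_tendsto_closedBall_norm_sub hloc)), hne]
    with z hz hz0
  have hpos : 0 < ‖z‖ ^ 2 := by
    have := norm_pos_iff.2 hz0
    positivity
  have hlim := tendsto_beurlingTrunc hf₀m hloc hp hFLp hz0 hz
  rw [hardy_indicator hpos, hf₀, Set.indicator_of_mem (Set.mem_Ioi.2 hpos), ← hf₀] at hlim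
  simp only [← htrunc] at hlim
  have hval : beurling F z = (‖z‖ : ℂ) ^ 2 / z ^ 2 * (f (‖z‖ ^ 2) - hardy f (‖z‖ ^ 2)) :=
    hlim.limUnder_eq
  refine ⟨⟨fun ε hε => ?_, ?_⟩, hval⟩
  · simpa only [mul_one_div] using integrableOn_mul_kernel hp hF z hε
  · rw [hval]
    exact hlim

lemma aestronglyMeasurable_hardy {f : ℝ → ℂ} {p : ℝ} (hp : 1 < p)
    (hf : MemLp f (ENNReal.ofReal p) (volume.restrict (Set.Ioi 0))) :
    AEStronglyMeasurable (hardy f) (volume.restrict (Set.Ioi 0)) := by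
  have h1p : 1 ≤ ENNReal.ofReal p := by rw [ENNReal.one_le_ofReal]; exact hp.le
  have hloc : LocallyIntegrable ((Set.Ioi 0).indicator f) :=
    ((memLp_indicator_iff_restrict measurableSet_Ioi).2 hf).locallyIntegrable h1p
  have hc : Continuous fun s => ∫ t in (0 : ℝ)..s, (Set.Ioi 0).indicator f t :=
    intervalIntegral.continuous_primitive
      (fun a b => (hloc.integrableOn_isCompact isCompact_uIcc).intervalIntegrable) 0
  have hm : Measurable (hardy ((Set.Ioi 0).indicator f)) := by
    have := hc.measurable
    have h2 : Measurable fun s : ℝ => (s : ℂ)⁻¹ := by fun_prop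
    exact h2.mul this
  refine hm.aestronglyMeasurable.congr ?_
  rw [EventuallyEq, ae_restrict_iff' measurableSet_Ioi]
  filter_upwards with s hs
  exact hardy_indicator hs

lemma eLpNorm_beurling {F : ℂ → ℂ} {f : ℝ → ℂ} {p : ℝ} (hp : 1 < p) (hf : Measurable f)
    (hF : MemLp F (ENNReal.ofReal p)) (hFf : F =ᵐ[volume] fun z => f (‖z‖ ^ 2)) :
    eLpNorm (beurling F) (ENNReal.ofReal p) = NNReal.pi ^ (ENNReal.ofReal p).toReal⁻¹ •
      eLpNorm (fun s => f s - hardy f s) (ENNReal.ofReal p) (volume.restrict (Set.Ioi 0)) := by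
  have hne : ∀ᵐ z : ℂ, z ≠ 0 := by simp [ae_iff]
  rw [← eLpNorm_comp_norm_sq (g := fun s => f s - hardy f s) (hf.aestronglyMeasurable.sub
    (aestronglyMeasurable_hardy hp (memLp_profile hf hF hFf)))]
  refine eLpNorm_congr_norm_ae ?_
  filter_upwards [ae_beurling_eq hp hf hF hFf, hne] with z hz hz0
  have : ‖z‖ ≠ 0 := norm_ne_zero_iff.2 hz0
  rw [hz.2, norm_mul, norm_div, norm_pow, norm_pow, Complex.norm_real, norm_norm,
    div_self (by positivity), one_mul]

lemma aestronglyMeasurable_beurling {F : ℂ → ℂ} {f : ℝ → ℂ} {p : ℝ} (hp : 1 < p)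
    (hf : Measurable f) (hF : MemLp F (ENNReal.ofReal p))
    (hFf : F =ᵐ[volume] fun z => f (‖z‖ ^ 2)) : AEStronglyMeasurable (beurling F) volume := by
  have h1 : AEStronglyMeasurable (fun z : ℂ => f (‖z‖ ^ 2) - hardy f (‖z‖ ^ 2)) volume := by
    have h2 : AEStronglyMeasurable (fun s => f s - hardy f s)
        ((volume : Measure ℂ).map (fun z => ‖z‖ ^ 2)) := by
      rw [map_norm_sq]
      exact (hf.aestronglyMeasurable.sub
        (aestronglyMeasurable_hardy hp (memLp_profile hf hF hFf))).smul_measure _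
    exact h2.comp_measurable (by fun_prop)
  have h3 : AEStronglyMeasurable (fun z : ℂ => (‖z‖ : ℂ) ^ 2 / z ^ 2) volume :=
    Measurable.aestronglyMeasurable (by fun_prop)
  refine (h3.mul h1).congr ?_
  filter_upwards [ae_beurling_eq hp hf hF hFf] with z hz
  exact hz.2.symm

lemma eLpNorm_sub_hardy_le {f : ℝ → ℂ} {p K c : ℝ} (hp : 1 < p) (hK : 1 ≤ K)
    (hc : 0 ≤ c) (h : ∀ x : ℝ, |x - 1| ^ p ≤ K * |x| ^ p + c * (p * (1 - x) - 1))
    (hf : MemLp f (ENNReal.ofReal p) (volume.restrict (Set.Ioi 0))) :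
    eLpNorm (fun s => f s - hardy f s) (ENNReal.ofReal p) (volume.restrict (Set.Ioi 0)) ≤
      ENNReal.ofReal (K ^ (1 / p)) * eLpNorm f (ENNReal.ofReal p) (volume.restrict (Set.Ioi 0)) := by
  have hp0 : 0 < p := by linarith
  have h0 : ENNReal.ofReal p ≠ 0 := by simpa using hp0
  rw [eLpNorm_eq_lintegral_rpow_enorm_toReal h0 ENNReal.ofReal_ne_top,
    eLpNorm_eq_lintegral_rpow_enorm_toReal h0 ENNReal.ofReal_ne_top, ENNReal.toReal_ofReal hp0.le,
    ← ENNReal.ofReal_rpow_of_nonneg (by linarith) (by positivity),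
    ← ENNReal.mul_rpow_of_nonneg _ _ (by positivity)]
  exact ENNReal.rpow_le_rpow (lintegral_sub_hardy_le hp hK hc h hf) (by positivity)

/-! ### Sharpness -/

/-- The profile `1` on `s ≤ 1`, `α s^(α - 1)` on `s > 1`. Its Hardy average is `1` on `(0, 1]` and
`s^(α - 1)` beyond, so that the ratio of `f` to `Hf` is the constant `α` on `(1, ∞)`. -/
noncomputable def extremalProfile (α : ℝ) (s : ℝ) : ℂ :=
  if s ≤ 1 then 1 else ((α * s ^ (α - 1) : ℝ) : ℂ)

lemma measurable_extremalProfile (α : ℝ) : Measurable (extremalProfile α) :=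
  Measurable.ite measurableSet_Iic measurable_const (by fun_prop)

lemma hardy_extremalProfile (α : ℝ) {s : ℝ} (hs : 0 < s) :
    hardy (extremalProfile α) s = if s ≤ 1 then 1 else ((s ^ (α - 1) : ℝ) : ℂ) := by
  have hle : ∀ u, 0 ≤ u → u ≤ 1 → ∫ t in (0 : ℝ)..u, extremalProfile α t = u := by
    intro u hu0 hu
    rw [intervalIntegral.integral_congr (g := fun _ => (1 : ℂ))]
    · simp
    · intro t ht
      rw [Set.uIcc_of_le hu0] at ht
      simp [extremalProfile, ht.2.trans hu]
  have hsC : (s : ℂ) ≠ 0 := by exact_mod_cast hs.ne'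
  rw [hardy]
  split_ifs with h1
  · rw [hle s hs.le h1, inv_mul_cancel₀ hsC]
  · have h1' : 1 < s := not_le.1 h1
    have hcongr : Set.EqOn (fun t : ℝ => ((α * t ^ (α - 1) : ℝ) : ℂ)) (extremalProfile α)
        (Set.uIoc 1 s) := by
      intro t ht
      rw [Set.uIoc_of_le h1'.le] at ht
      simp only [extremalProfile]
      rw [if_neg (not_le.2 ht.1)]
    have hcont : ContinuousOn (fun t : ℝ => α * t ^ (α - 1)) (Set.uIcc 1 s) := by
      rw [Set.uIcc_of_le h1'.le]
      intro t ht
      exact (continuousAt_const.mul (Real.continuousAt_rpow_const _ _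
        (Or.inl (by linarith [ht.1])))).continuousWithinAt
    have hi2 : IntervalIntegrable (fun t : ℝ => ((α * t ^ (α - 1) : ℝ) : ℂ)) volume 1 s :=
      (Complex.continuous_ofReal.comp_continuousOn hcont).intervalIntegrable
    have hi1 : IntervalIntegrable (extremalProfile α) volume 0 1 := by
      refine (intervalIntegrable_const (c := (1 : ℂ))).congr fun t ht => ?_
      rw [Set.uIoc_of_le zero_le_one] at ht
      simp [extremalProfile, ht.2]
    have e2 : ∫ t in (1 : ℝ)..s, extremalProfile α t = ((s ^ α - 1 : ℝ) : ℂ) := by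
      rw [← intervalIntegral.integral_congr_ae (Eventually.of_forall hcongr), intervalIntegral.integral_ofReal,
        intervalIntegral.integral_eq_sub_of_hasDerivAt (f := fun t => t ^ α) _
          hcont.intervalIntegrable, Real.one_rpow]
      intro t ht
      rw [Set.uIcc_of_le h1'.le] at ht
      exact Real.hasDerivAt_rpow_const (Or.inl (by linarith [ht.1]))
    rw [← intervalIntegral.integral_add_adjacent_intervals hi1 (hi2.congr hcongr), e2,
      hle 1 zero_le_one le_rfl, Real.rpow_sub_one hs.ne']
    push_cast
    field_simp
    ring

lemma lintegral_piecewise_rpow {a b β p : ℝ} (hp : 1 < p) (hβ : p * β < -1) {g : ℝ → ℂ}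
    (h1 : ∀ s, 0 < s → s ≤ 1 → g s = (a : ℂ))
    (h2 : ∀ s, 1 < s → g s = ((b * s ^ β : ℝ) : ℂ)) :
    ∫⁻ s in Set.Ioi 0, ‖g s‖ₑ ^ p = ENNReal.ofReal (|a| ^ p + |b| ^ p / (-(p * β) - 1)) := by
  have hp0 : 0 < p := by linarith
  rw [← Set.Ioc_union_Ioi_eq_Ioi (zero_le_one (α := ℝ)),
    lintegral_union measurableSet_Ioi (Set.Ioc_disjoint_Ioi le_rfl),
    ENNReal.ofReal_add (by positivity) (div_nonneg (by positivity) (by linarith))]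
  congr 1
  · rw [setLIntegral_congr_fun (g := fun _ => ENNReal.ofReal (|a| ^ p)) measurableSet_Ioc]
    · simp
    · intro s hs
      simp only
      rw [h1 s hs.1 hs.2, ← ofReal_norm, Complex.norm_real, Real.norm_eq_abs,
        ENNReal.ofReal_rpow_of_nonneg (abs_nonneg _) hp0.le]
  · have hint := integrableOn_Ioi_rpow_of_lt hβ zero_lt_one
    rw [setLIntegral_congr_fun (g := fun s => ENNReal.ofReal (|b| ^ p * s ^ (p * β)))
      measurableSet_Ioi]
    · rw [← ofReal_integral_eq_lintegral_ofReal (hint.const_mul _), integral_const_mul,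
        integral_Ioi_rpow_of_lt hβ zero_lt_one, Real.one_rpow]
      · congr 1
        have e1 : p * β + 1 ≠ 0 := by linarith
        have e2 : -(p * β) - 1 ≠ 0 := by linarith
        field_simp
        ring
      · rw [EventuallyLE, ae_restrict_iff' measurableSet_Ioi]
        filter_upwards with s hs
        have : 0 < s := zero_lt_one.trans hs
        simp only [Pi.zero_apply]
        positivity
    · intro s hs
      have hs0 : 0 < s := zero_lt_one.trans hs
      simp only
      rw [h2 s hs, ← ofReal_norm, Complex.norm_real, Real.norm_eq_abs, abs_mul,
        ENNReal.ofReal_rpow_of_nonneg (by positivity) hp0.le,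
        Real.mul_rpow (abs_nonneg _) (abs_nonneg _), abs_of_pos (by positivity : 0 < s ^ β),
        ← Real.rpow_mul hs0.le, mul_comm β p]

/-- The test function `extremalProfile α` shows that every admissible constant dominates the
quotient at `α`. -/
lemma quotient_le_of_bound {p C α : ℝ} (hp : 1 < p) (hC : 0 ≤ C) (hα : α < (p - 1) / p)
    (h : ∀ F : ℂ → ℂ, IsRadial F → MemLp F (ENNReal.ofReal p) →
      eLpNorm (beurling F) (ENNReal.ofReal p) ≤
        ENNReal.ofReal C * eLpNorm F (ENNReal.ofReal p)) :
    |α - 1| ^ p ≤ C ^ p * (p * (1 - α) - 1 + |α| ^ p) := by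
  have hp0 : 0 < p := by linarith
  have h0 : ENNReal.ofReal p ≠ 0 := by simpa using hp0
  have hβ : p * (α - 1) < -1 := by
    have := (lt_div_iff₀ hp0).1 hα
    linarith
  set f := extremalProfile α with hf
  have hfm : Measurable f := measurable_extremalProfile α
  have hX : ∫⁻ s in Set.Ioi 0, ‖f s‖ₑ ^ p =
      ENNReal.ofReal (|1| ^ p + |α| ^ p / (-(p * (α - 1)) - 1)) :=
    lintegral_piecewise_rpow hp hβ (fun s _ hs => by simp [hf, extremalProfile, hs])
      (fun s hs => by simp [hf, extremalProfile, not_le.2 hs])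
  have hY : ∫⁻ s in Set.Ioi 0, ‖f s - hardy f s‖ₑ ^ p =
      ENNReal.ofReal (|0| ^ p + |α - 1| ^ p / (-(p * (α - 1)) - 1)) := by
    refine lintegral_piecewise_rpow hp hβ (fun s hs0 hs => ?_) (fun s hs => ?_)
    · rw [hf, hardy_extremalProfile α hs0]
      simp [extremalProfile, hs]
    · rw [hf, hardy_extremalProfile α (by linarith)]
      simp only [extremalProfile, not_le.2 hs, if_false]
      push_cast
      ring
  rw [abs_one, Real.one_rpow] at hX
  rw [abs_zero, Real.zero_rpow hp0.ne', zero_add] at hY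
  set F : ℂ → ℂ := fun z => f (‖z‖ ^ 2) with hF
  have hnorm : ∀ g : ℝ → ℂ, eLpNorm g (ENNReal.ofReal p) (volume.restrict (Set.Ioi 0)) =
      (∫⁻ s in Set.Ioi 0, ‖g s‖ₑ ^ p) ^ (1 / p) := fun g => by
    rw [eLpNorm_eq_lintegral_rpow_enorm_toReal h0 ENNReal.ofReal_ne_top,
      ENNReal.toReal_ofReal hp0.le]
  have hFn : eLpNorm F (ENNReal.ofReal p) = NNReal.pi ^ (ENNReal.ofReal p).toReal⁻¹ •
      eLpNorm f (ENNReal.ofReal p) (volume.restrict (Set.Ioi 0)) :=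
    eLpNorm_comp_norm_sq hfm.aestronglyMeasurable
  have hFm : MemLp F (ENNReal.ofReal p) := by
    refine ⟨(hfm.comp (by fun_prop)).aestronglyMeasurable, ?_⟩
    rw [hFn, hnorm, hX]
    exact ENNReal.mul_lt_top ENNReal.coe_lt_top
      (ENNReal.rpow_lt_top_of_nonneg (by positivity) ENNReal.ofReal_ne_top)
  have hle := h F ⟨f, Eventually.of_forall fun z => rfl⟩ hFm
  rw [eLpNorm_beurling hp hfm hFm (Eventually.of_forall fun z => rfl), hFn, ENNReal.smul_def,
    ENNReal.smul_def, smul_eq_mul, smul_eq_mul, mul_left_comm] at hle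
  have hpi : ((NNReal.pi ^ (ENNReal.ofReal p).toReal⁻¹ : NNReal) : ENNReal) ≠ 0 := by
    rw [ENNReal.coe_ne_zero]
    exact (NNReal.rpow_pos (pos_iff_ne_zero.2 NNReal.pi_ne_zero)).ne'
  rw [ENNReal.mul_le_mul_iff_right hpi ENNReal.coe_ne_top, hnorm, hnorm, hX, hY] at hle
  have hle2 := ENNReal.rpow_le_rpow hle hp0.le
  have hm : 0 < -(p * (α - 1)) - 1 := by linarith
  rw [ENNReal.mul_rpow_of_nonneg _ _ hp0.le, ← ENNReal.rpow_mul, ← ENNReal.rpow_mul,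
    one_div_mul_cancel hp0.ne', ENNReal.rpow_one, ENNReal.rpow_one,
    ENNReal.ofReal_rpow_of_nonneg hC hp0.le, ← ENNReal.ofReal_mul (by positivity),
    ENNReal.ofReal_le_ofReal_iff (by positivity), div_le_iff₀ hm] at hle2
  refine hle2.trans (le_of_eq ?_)
  field_simp
  ring

theorem corollary2 (p : ℝ) (hp : 1 < p) :
    -- the Beurling–Ahlfors transform of a radial `L^p` function exists a.e. and is in `L^p`
    (∀ F : ℂ → ℂ, IsRadial F → MemLp F (ENNReal.ofReal p) →
      (∀ᵐ z : ℂ, BeurlingExistsAt F z) ∧ MemLp (beurling F) (ENNReal.ofReal p)) ∧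
    -- `C_p` is the best constant in the inequality `‖BF‖_p ≤ C ‖F‖_p` for radial `F`
    IsLeast {C : ℝ | 0 ≤ C ∧ ∀ F : ℂ → ℂ, IsRadial F → MemLp F (ENNReal.ofReal p) →
        eLpNorm (beurling F) (ENNReal.ofReal p) ≤
          ENNReal.ofReal C * eLpNorm F (ENNReal.ofReal p)}
      (radialConst p) ∧
    -- the supremum defining `C_p ^ p` is a genuine one, and `C_p` has the following values
    IsLUB (radialQuotients p) (radialConst p ^ p) ∧
    (p ≤ 2 → radialConst p = 1 / (p - 1)) ∧
    (2 < p →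
      (∃! α : ℝ, α < 0 ∧ (p - 1) * α + 2 - p = |α| ^ (p - 2) * α) ∧
      ∀ α : ℝ, α < 0 → (p - 1) * α + 2 - p = |α| ^ (p - 2) * α →
        radialConst p ^ p = (1 + |α|) ^ (p - 2) / (p - 1)) := by
  have hp0 : 0 < p := by linarith
  obtain ⟨K, c, hK1, hc0, hscalar, hlub, hle2, hgt2⟩ := exists_sharp_constants hp
  have hK0 : 0 ≤ K := by linarith
  have hC : radialConst p = K ^ (1 / p) := by
    rw [radialConst, hlub.csSup_eq ⟨_, (p - 1) / p, le_rfl, rfl⟩]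
  have hCp : radialConst p ^ p = K := by
    rw [hC, ← Real.rpow_mul hK0, one_div_mul_cancel hp0.ne', Real.rpow_one]
  have hbound : ∀ F : ℂ → ℂ, IsRadial F → MemLp F (ENNReal.ofReal p) →
      eLpNorm (beurling F) (ENNReal.ofReal p) ≤
        ENNReal.ofReal (radialConst p) * eLpNorm F (ENNReal.ofReal p) := by
    intro F hr hF
    obtain ⟨f, hf, hFf⟩ := hr.exists_measurable_profile hF.1
    rw [eLpNorm_beurling hp hf hF hFf, eLpNorm_congr_ae hFf,
      eLpNorm_comp_norm_sq hf.aestronglyMeasurable, hC, ENNReal.smul_def, ENNReal.smul_def,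
      smul_eq_mul, smul_eq_mul, mul_left_comm]
    exact mul_le_mul' le_rfl (eLpNorm_sub_hardy_le hp hK1 hc0 hscalar (memLp_profile hf hF hFf))
  refine ⟨fun F hr hF => ?_, ⟨⟨?_, hbound⟩, ?_⟩, ?_, fun h2 => ?_, fun h2 => ⟨?_, ?_⟩⟩
  · obtain ⟨f, hf, hFf⟩ := hr.exists_measurable_profile hF.1
    exact ⟨(ae_beurling_eq hp hf hF hFf).mono fun z hz => hz.1,
      aestronglyMeasurable_beurling hp hf hF hFf,
      (hbound F hr hF).trans_lt (ENNReal.mul_lt_top ENNReal.ofReal_lt_top hF.2)⟩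
  · rw [hC]
    positivity
  · rintro C ⟨hC0, hCb⟩
    have hall : ∀ α, α ≤ (p - 1) / p → |α - 1| ^ p ≤ C ^ p * (p * (1 - α) - 1 + |α| ^ p) := by
      intro α hα
      rcases eq_or_lt_of_le hα with heq | hlt
      · -- the extremal profile leaves `L^p` at the endpoint, which is reached by continuity
        have hcl : Continuous fun α : ℝ => |α - 1| ^ p :=
          (continuous_abs.comp (continuous_id.sub continuous_const)).rpow_const
            fun _ => Or.inr hp0.le
        have hcr : Continuous fun α : ℝ => C ^ p * (p * (1 - α) - 1 + |α| ^ p) := by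
          have : Continuous fun α : ℝ => |α| ^ p :=
            continuous_abs.rpow_const fun _ => Or.inr hp0.le
          fun_prop
        refine le_of_tendsto_of_tendsto ((hcl.tendsto α).mono_left nhdsWithin_le_nhds)
          ((hcr.tendsto α).mono_left (nhdsWithin_le_nhds (s := Set.Iio α))) ?_
        filter_upwards [self_mem_nhdsWithin] with β hβ
        have hβ' : β < α := hβ
        exact quotient_le_of_bound hp hC0 (by linarith) hCb
      · exact quotient_le_of_bound hp hC0 hlt hCb
    have hKC : K ≤ C ^ p := by
      refine hlub.2 ?_
      rintro y ⟨α, hα, rfl⟩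
      rw [div_le_iff₀ (radialQuotients_den_pos hp hα).2]
      exact hall α hα
    rw [hC, one_div]
    exact (Real.rpow_inv_le_iff_of_pos hK0 hC0 hp0).2 hKC
  · rw [hCp]
    exact hlub
  · rw [hC, hle2 h2, ← Real.rpow_mul (div_nonneg zero_le_one (by linarith)),
      mul_one_div_cancel hp0.ne', Real.rpow_one]
  · exact existsUnique_neg_root h2
  · intro α hα hroot
    rw [hCp, hgt2 h2 (-α) (by linarith) ((neg_root_iff hα).1 hroot), abs_of_neg hα]
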